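/- **Setting.** Let $n\ge 2$, let $\eta>0$, $\eta\neq 1$ be a constant, and let $0<\alpha\le 1$. Let $D,\Omega\subset\mathbb R^n$ be bounded Lipschitz domains with $\overline D\subset\Omega$ and $\Omega\setminus\overline D$ connected, put $\gamma=1+(\eta-1)\chi_D$, and let $u\in H^1(\Omega)$ be a weak solution of $\operatorname{div}(\gamma\nabla u)=0$ in $\Omega$ (with an arbitrary Neumann datum on $\partial\Omega$). Put $u_i=u|_D$ and $u_e=u|_{\Omega\setminus\overline D}$ (harmonic representatives). Let $\mathbf p\in\partial D$ be an admissible $K$-curvature point with parameters $L,M,\delta$ (all positive, $M\ge1$). This means that, with $b=\sqrt M/K$, $h=1/K$ and $\mathbf x=(\mathbf x',x_n)$, in the coordinates obtained from a rigid motion taking $\mathbf p$ to $\mathbf 0$, there are constants $0<K_-\le K\le K_+<\infty$ and a $C^{2,1}$ function $w\ge 0$ on $B(\mathbf 0',b)\subset\mathbb R^{n-1}$ such that, with $U_{b,h}=B(\mathbf 0',b)\times(-h,h)$ and $D_{b,h}=U_{b,h}\cap D$, * $D_{b,h}=\{\mathbf x:\ |\mathbf x'|<b,\ -h<x_n<h,\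 w(\mathbf x')<x_n\}$, and $\mathbf e_n$ is the interior unit normal to $\partial D$ at $\mathbf 0$; * $w(\mathbf x')=K|\mathbf x'|^2+O(|\mathbf x'|^3)$ and $K_-|\mathbf x'|^2\le w(\mathbf x')\le K_+|\mathbf x'|^2$ on $B(\mathbf 0',b)$; * $M^{-1}\le K_\pm/K\le M$ and $K_+-K_-\le L K^{1-\delta}$; * $\overline{D_{b,h}}\cap(\mathbb R^{n-1}\times\{h\})$ is (the closure of) a Lipschitz domain in $\mathbb R^{n-1}$. Fix such $K_\pm$ and such coordinates. Assume $U_{b,h}\subset\Omega$ and that $u_e$ extends harmonically into $D_{b,h}$, so that $u_e$ is harmonic in $U_{b,h}$. Write $\nabla u_i(\mathbf p)$ for the limit of $\nabla u_i$ at $\mathbf p$ from within $D$, assumed to exist (it does whenever the norm of $u_i$ below is finite), and, for a function $f$, $$\|f\|=\|f\|_{C^{1,\alpha}(\overline{D_{b,h}})}=\sup_{D_{b,h}}|f|+\sup_{D_{b,h}}|\nabla f|+\sup_{\mathbf x\ne \mathbf y\in D_{b,h}}\frac{|\nabla f(\mathbf x)-\nabla f(\mathbf y)|}{|\mathbf x-\mathbf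 y|^\alpha}\in[0,\infty].$$ **Theorem.** For $\tau>0$ let $u_0(\mathbf x)=\exp(\xi\cdot\mathbf x)$ with $\xi=\mathrm i\tau\hat{\mathbf v}-\tau\mathbf e_n\in\mathbb C^n$, where $$\hat{\mathbf v}=\frac{\nabla u_i(\mathbf p)-(\nabla u_i(\mathbf p)\cdot\mathbf e_n)\mathbf e_n}{|\nabla u_i(\mathbf p)-(\nabla u_i(\mathbf p)\cdot\mathbf e_n)\mathbf e_n|}\ \text{ if } \nabla u_i(\mathbf p)\nparallel\mathbf e_n,\qquad \hat{\mathbf v}=\mathbf e_1\ \text{ otherwise.}$$ Then $u_0$ is harmonic in $U_{b,h}$, and there is a constant $C=C_{n,\eta,\alpha}>0$, depending only on $n,\eta,\alpha$, such that for every $\tau>0$ $$\begin{aligned} C\,|\nabla u_i(\mathbf p)|\le{}&\|u_i\|\,\bigl(1+(\tau h)^{\frac{n-1}2}\bigr)e^{\tau(\frac1{4K}-h)} +\|u_i\|\Bigl(\bigl(\tfrac K{K_-}\bigr)^{\frac{n-1}2}-\bigl(\tfrac K{K_+}\bigr)^{\frac{n-1}2}\Bigr)e^{\frac{\tau}{4K}}\\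 &+\|u_i\|\,(h+K_-^{-1})^{\frac\alpha2}\,h^{\frac{n+1+\alpha}2}\bigl(\tfrac K{K_-}\bigr)^{\frac{n-1}2}\tau^{\frac{n+1}2}e^{\frac{\tau}{4K}}\\ &+\bigl(\|u_i\|+\|u_e\|\bigr)h^{\alpha+\frac{n-1}2}\bigl(\tfrac K{K_-}\bigr)^{\frac{n-1}2}(1+\tau h)\,\tau^{\frac{n-1}2}e^{\tau(\frac1{4K}-h)} . \end{aligned}$$ -/

import Mathlib

open MeasureTheory Filter Set Topology InnerProductSpace
open scoped ENNReal ContDiff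

/-! Throughout, `ℝⁿ` with `n = d + 1` is `EuclideanSpace ℝ (Fin (d + 1))`, and a point `x` of it is
split as `x = (x', xₙ)` with `x' ∈ ℝ^(n-1)`. -/

/-- The first `n - 1` coordinates `x'` of `x = (x', xₙ)`. -/
def horiz {d : ℕ} (x : EuclideanSpace ℝ (Fin (d + 1))) : EuclideanSpace ℝ (Fin d) :=
  WithLp.toLp 2 (fun i => x (Fin.castSucc i))

/-- The last coordinate `xₙ` of `x = (x', xₙ)`. -/
def vert {d : ℕ} (x : EuclideanSpace ℝ (Fin (d + 1))) : ℝ := x (Fin.last d)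

/-- The open cylinder `B(0', b) × (-h, h)`. -/
def tipCylinder (d : ℕ) (b h : ℝ) : Set (EuclideanSpace ℝ (Fin (d + 1))) :=
  {x | ‖horiz x‖ < b ∧ -h < vert x ∧ vert x < h}

/-- A Lipschitz domain: open, connected, and near each boundary point equal to the strict
epigraph, in the direction of some unit vector `e`, of a Lipschitz function `g` of the component
orthogonal to `e`. -/
structure IsLipschitzDomain {E : Type*} [NormedAddCommGroup E] [InnerProductSpace ℝ E]
    (S : Set E) : Prop where
  isOpen : IsOpen S
  isConnected : IsConnected S
  graph : ∀ x ∈ frontier S, ∃ e : E, ‖e‖ = 1 ∧ ∃ (g : E → ℝ) (c : NNReal), LipschitzWith c g ∧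
    ∀ᶠ y in 𝓝 x, (y ∈ S ↔ g (y - (inner ℝ e y) • e) < inner ℝ e y)

/-- `p ∈ ∂D` is an admissible `K`-curvature point of `D` with parameters `L, M, δ`, where
`b = √M / K`, `h = 1 / K`; the rigid motion `Φ` (moving `p` to the origin), the local graph
function `w` and the constants `K₋ ≤ K ≤ K₊` are kept explicit. That `eₙ` is the interior unit
normal at the origin is expressed by `graph` and `expansion`: near the origin `Φ(D)` is
`{xₙ > w(x')}` with `w(0) = 0`, `∇w(0) = 0`. -/
structure IsAdmissibleKCurvaturePoint {d : ℕ} (D : Set (EuclideanSpace ℝ (Fin (d + 1))))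
    (p : EuclideanSpace ℝ (Fin (d + 1))) (K L M δ Kminus Kplus : ℝ)
    (w : EuclideanSpace ℝ (Fin d) → ℝ)
    (Φ : EuclideanSpace ℝ (Fin (d + 1)) ≃ᵃⁱ[ℝ] EuclideanSpace ℝ (Fin (d + 1))) : Prop where
  K_pos : 0 < K
  L_pos : 0 < L
  delta_pos : 0 < δ
  mem_frontier : p ∈ frontier D
  map_point : Φ p = 0
  /-- `w` is of class `C^{2,1}` on `B(0', b)`. -/
  contDiffOn : ContDiffOn ℝ 2 w (Metric.ball 0 (√M / K))
  lipschitz : LocallyLipschitzOn (Metric.ball 0 (√M / K)) (iteratedFDeriv ℝ 2 w)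
  nonneg : ∀ y ∈ Metric.ball (0 : EuclideanSpace ℝ (Fin d)) (√M / K), 0 ≤ w y
  /-- In the new coordinates `D ∩ (B(0', b) × (-h, h)) = {|x'| < b, -h < xₙ < h, w(x') < xₙ}`. -/
  graph : (Φ '' D) ∩ tipCylinder d (√M / K) (1 / K) =
    {x | x ∈ tipCylinder d (√M / K) (1 / K) ∧ w (horiz x) < vert x}
  expansion : ∃ c : ℝ, ∀ y ∈ Metric.ball (0 : EuclideanSpace ℝ (Fin d)) (√M / K),
    |w y - K * ‖y‖ ^ 2| ≤ c * ‖y‖ ^ 3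
  one_le_M : 1 ≤ M
  Kminus_pos : 0 < Kminus
  Kminus_le : Kminus ≤ K
  le_Kplus : K ≤ Kplus
  bounds : ∀ y ∈ Metric.ball (0 : EuclideanSpace ℝ (Fin d)) (√M / K),
    Kminus * ‖y‖ ^ 2 ≤ w y ∧ w y ≤ Kplus * ‖y‖ ^ 2
  ratio_minus : M⁻¹ ≤ Kminus / K ∧ Kminus / K ≤ M
  ratio_plus : M⁻¹ ≤ Kplus / K ∧ Kplus / K ≤ M
  pinching : Kplus - Kminus ≤ L * K ^ (1 - δ)
  /-- The slice `{x' : (x', h) ∈ closure D_{b,h}}` is (the closure of) a Lipschitz domain of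
  `ℝ^(n-1)`. -/
  slice : ∃ W : Set (EuclideanSpace ℝ (Fin d)), IsLipschitzDomain W ∧
    horiz '' (closure ((Φ '' D) ∩ tipCylinder d (√M / K) (1 / K)) ∩ {x | vert x = 1 / K}) = closure W

/-- `G` is the weak gradient of `u` in the open set `Ω`. -/
def IsWeakGradient {d : ℕ} (Ω : Set (EuclideanSpace ℝ (Fin (d + 1))))
    (u : EuclideanSpace ℝ (Fin (d + 1)) → ℝ)
    (G : EuclideanSpace ℝ (Fin (d + 1)) → EuclideanSpace ℝ (Fin (d + 1))) : Prop :=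
  ∀ φ : EuclideanSpace ℝ (Fin (d + 1)) → ℝ, ContDiff ℝ ∞ φ → HasCompactSupport φ →
    tsupport φ ⊆ Ω → ∫ x in Ω, u x • gradient φ x = -∫ x in Ω, φ x • G x

/-- The conductivity `γ = 1 + (η - 1) χ_D`. -/
noncomputable def conductivity {d : ℕ} (η : ℝ) (D : Set (EuclideanSpace ℝ (Fin (d + 1))))
    (x : EuclideanSpace ℝ (Fin (d + 1))) : ℝ :=
  1 + (η - 1) * D.indicator (fun _ => (1 : ℝ)) x

/-- `u ∈ H¹(Ω)` is a weak solution of `div (γ ∇u) = 0` in `Ω`, `γ = 1 + (η - 1) χ_D`. No boundary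
condition is imposed on `∂Ω`: the Neumann datum of `u` may be arbitrary. -/
def IsConductivitySolution {d : ℕ} (Ω D : Set (EuclideanSpace ℝ (Fin (d + 1)))) (η : ℝ)
    (u : EuclideanSpace ℝ (Fin (d + 1)) → ℝ) : Prop :=
  MemLp u 2 (volume.restrict Ω) ∧
  ∃ G : EuclideanSpace ℝ (Fin (d + 1)) → EuclideanSpace ℝ (Fin (d + 1)),
    MemLp G 2 (volume.restrict Ω) ∧ IsWeakGradient Ω u G ∧
    ∀ φ : EuclideanSpace ℝ (Fin (d + 1)) → ℝ, ContDiff ℝ ∞ φ → HasCompactSupport φ →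
      tsupport φ ⊆ Ω → ∫ x in Ω, conductivity η D x * inner ℝ (G x) (gradient φ x) = 0

/-- The norm of `C^{1,α}(closure S)`, `S` open, with values in `[0, ∞]`:
`sup |f| + sup |∇f| + sup |∇f(x) - ∇f(y)| / |x - y|^α` over points of `S`. The suprema over `S`
and over its closure agree when `f` and `∇f` extend continuously, which they do if the value is
finite and `S` is bounded with Lipschitz boundary. Terms with `x = y` are `0 / 0 = 0`. -/
noncomputable def holderNorm {d : ℕ} (α : ℝ) (S : Set (EuclideanSpace ℝ (Fin (d + 1))))
    (f : EuclideanSpace ℝ (Fin (d + 1)) → ℝ) : ℝ≥0∞ :=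
  (⨆ x ∈ S, ‖f x‖ₑ) + (⨆ x ∈ S, ‖gradient f x‖ₑ) +
    ⨆ x ∈ S, ⨆ y ∈ S, edist (gradient f x) (gradient f y) / edist x y ^ α

/-- The unit vector `eₙ = (0, …, 0, 1)`. -/
noncomputable def eLast (d : ℕ) : EuclideanSpace ℝ (Fin (d + 1)) :=
  EuclideanSpace.single (Fin.last d) 1

open Classical in
/-- The vector `v̂` built from a vector `a`: the normalized component of `a` orthogonal to `eₙ`, or
`e₁` if `a` is parallel to `eₙ` (that is, if this component vanishes). -/
noncomputable def vHat {d : ℕ} (a : EuclideanSpace ℝ (Fin (d + 1))) :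
    EuclideanSpace ℝ (Fin (d + 1)) :=
  if a - (inner ℝ a (eLast d)) • eLast d = 0 then EuclideanSpace.single 0 1
  else ‖a - (inner ℝ a (eLast d)) • eLast d‖⁻¹ • (a - (inner ℝ a (eLast d)) • eLast d)

/-- The complex vector `ξ = i τ v̂ - τ eₙ`. -/
noncomputable def cgoVector {d : ℕ} (τ : ℝ) (a : EuclideanSpace ℝ (Fin (d + 1))) :
    Fin (d + 1) → ℂ :=
  fun j => Complex.I * τ * (vHat a j : ℂ) - τ * (eLast d j : ℂ)

/-- The complex geometric optics function `u₀(x) = exp (ξ · x)`. -/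
noncomputable def cgo {d : ℕ} (τ : ℝ) (a : EuclideanSpace ℝ (Fin (d + 1)))
    (x : EuclideanSpace ℝ (Fin (d + 1))) : ℂ :=
  Complex.exp (∑ j, cgoVector τ a j * (x j : ℂ))

/-! Near `p`, write `a = ∇uᵢ`, `e = ∇uₑ`, `g = ∇uᵢ(p)` in the rotated coordinates, and let `S` be
the part of `D` in the cylinder. The weak equation carries two transmission laws: `η a - e` has zero
integral over `S` against gradients of test functions (continuity of flux), and `a - e` has zero
integral against the fields `∂_v φ z - ∂_z φ v` (continuity of the tangential gradient). Both follow
by subtracting from the identities for the weak gradient of `u` those for `∇uₑ`, which is defined on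
the whole cylinder; everything outside `D` cancels (`IsConductivitySolution.transmission`). Because
`S` meets the boundary of the cylinder only at the lid `xₙ = h`, test functions need to vanish only
near the lid (`transmission_image`).

The vector `g` lies in the plane of `v̂` and `eₙ`. Choose real combinations `f`, `Q` of the real and
imaginary parts of `u₀`, conjugate in that plane, so that `∇f = ∂_v Q eₙ - ∂ₙQ v`. Test the flux law
with `ψ(xₙ) f`, the tangential law with `ψ(xₙ) Q`, and subtract: `e` disappears except where `ψ' ≠
0`, leaving `(η - 1) ∫ ψ a · ∇f` plus lid terms. Moreover `g · ∇f = τ |g|² exp (-τ xₙ) cos (τ v·x)`,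
so freezing `a` at `g` bounds `|g|²` times an explicit oscillatory integral by the Hölder
oscillation of `a` and the lid terms (`abs_main_integral_le`). The lid terms gain the factor `h^α`
as well: testing with `ψ` alone shows that the relevant components of `η a - e` and `a - e` have
weighted mean zero, hence are bounded by their oscillation.

For the oscillatory integral, integration in `xₙ` gives `exp (-τ w) / τ`. Replacing `w` by `K |x'|²`
yields the Fourier transform of a Gaussian, of size `(π / (τ K))^((n-1)/2) exp (-τ / (4K)) / τ`; its
decay is the origin of the growth `exp (τ / (4K))` in the estimate. The replacement costs the
difference of the Gaussian masses for `K₋` and `K₊`, and the cutoff costs about `exp (-τ h / 2)`,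
negligible when `τ / K` is large (`abs_integral_cos_sub_le`).

Dividing by the Gaussian amplitude settles the case of large `τ / K` and `K ≤ 4 K₋`
(`exists_estimate_of_large_frequency`). Otherwise the first or the second term of the right-hand
side is bounded below, and `|g| ≤ ‖uᵢ‖` suffices. -/

/-! ### Coordinates `(x', xₙ)` and Fubini's theorem. -/

/-- The linear isometric splitting of coordinates, as a measurable equivalence. -/
noncomputable def splitLast (d : ℕ) :
    EuclideanSpace ℝ (Fin (d + 1)) ≃ᵐ ℝ × EuclideanSpace ℝ (Fin d) :=
  (MeasurableEquiv.toLp 2 (Fin (d + 1) → ℝ)).symm.trans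
    ((MeasurableEquiv.piFinSuccAbove (fun _ => ℝ) (Fin.last d)).trans
      ((MeasurableEquiv.refl ℝ).prodCongr (MeasurableEquiv.toLp 2 (Fin d → ℝ))))

lemma splitLast_apply {d : ℕ} (x : EuclideanSpace ℝ (Fin (d + 1))) :
    splitLast d x = (vert x, horiz x) := by
  refine Prod.ext rfl ?_
  ext i
  simp only [splitLast, horiz, MeasurableEquiv.piFinSuccAbove, MeasurableEquiv.trans_apply]
  simp [MeasurableEquiv.prodCongr, Fin.init]

lemma measurePreserving_splitLast (d : ℕ) :
    MeasurePreserving (splitLast d) volume (volume.prod volume) := by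
  have h1 := EuclideanSpace.volume_preserving_symm_measurableEquiv_toLp (Fin (d + 1))
  have h2 := volume_preserving_piFinSuccAbove (fun _ : Fin (d + 1) => ℝ) (Fin.last d)
  have h3 : MeasurePreserving (MeasurableEquiv.toLp 2 (Fin d → ℝ)) volume volume :=
    PiLp.volume_preserving_toLp (Fin d)
  exact (((MeasurePreserving.id (volume : Measure ℝ)).prod h3).comp h2).comp h1

/-- The horizontal part as a continuous linear map. -/
noncomputable def horizL (d : ℕ) :
    EuclideanSpace ℝ (Fin (d + 1)) →L[ℝ] EuclideanSpace ℝ (Fin d) :=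
  LinearMap.toContinuousLinearMap
    { toFun := horiz
      map_add' := fun _ _ => by ext; simp [horiz]
      map_smul' := fun _ _ => by ext; simp [horiz] }

/-- The last coordinate as a continuous linear map. -/
noncomputable def vertL (d : ℕ) : EuclideanSpace ℝ (Fin (d + 1)) →L[ℝ] ℝ :=
  LinearMap.toContinuousLinearMap
    { toFun := vert
      map_add' := fun _ _ => by simp [vert]
      map_smul' := fun _ _ => by simp [vert] }

@[simp] lemma vertL_apply {d : ℕ} (x : EuclideanSpace ℝ (Fin (d + 1))) :
    vertL d x = vert x := rfl

lemma continuous_horiz {d : ℕ} : Continuous (horiz (d := d)) := (horizL d).continuous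

lemma continuous_vert {d : ℕ} : Continuous (vert (d := d)) := (vertL d).continuous

lemma inner_eLast {d : ℕ} (x : EuclideanSpace ℝ (Fin (d + 1))) :
    inner ℝ x (eLast d) = vert x := by
  simp [eLast, vert, EuclideanSpace.inner_single_right]

lemma norm_eLast (d : ℕ) : ‖eLast d‖ = 1 := by simp [eLast]

lemma inner_eq_horiz_add_vert {d : ℕ} (x y : EuclideanSpace ℝ (Fin (d + 1))) :
    inner ℝ x y = inner ℝ (horiz x) (horiz y) + vert x * vert y := by
  simp [PiLp.inner_apply, Fin.sum_univ_castSucc, horiz, vert, mul_comm]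

lemma norm_sq_eq_horiz_add_vert {d : ℕ} (x : EuclideanSpace ℝ (Fin (d + 1))) :
    ‖x‖ ^ 2 = ‖horiz x‖ ^ 2 + vert x ^ 2 := by
  rw [← real_inner_self_eq_norm_sq, ← real_inner_self_eq_norm_sq, inner_eq_horiz_add_vert, sq]

lemma isOpen_tipCylinder (d : ℕ) (b h : ℝ) : IsOpen (tipCylinder d b h) := by
  unfold tipCylinder
  have h1 := continuous_horiz (d := d)
  have h2 := continuous_vert (d := d)
  exact (isOpen_lt h1.norm continuous_const).inter
    ((isOpen_lt continuous_const h2).inter (isOpen_lt h2 continuous_const))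

/-- The graph of a measurable function over the horizontal space is a null set. -/
lemma volume_graph_eq_zero {d : ℕ} {w : EuclideanSpace ℝ (Fin d) → ℝ} (hw : Measurable w) :
    volume {x : EuclideanSpace ℝ (Fin (d + 1)) | vert x = w (horiz x)} = 0 := by
  have hs : MeasurableSet {p : ℝ × EuclideanSpace ℝ (Fin d) | p.1 = w p.2} :=
    measurableSet_eq_fun measurable_fst (hw.comp measurable_snd)
  have : {x : EuclideanSpace ℝ (Fin (d + 1)) | vert x = w (horiz x)}
      = splitLast d ⁻¹' {p | p.1 = w p.2} := by
    ext x; simp [splitLast_apply]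
  rw [this, (measurePreserving_splitLast d).measure_preimage hs.nullMeasurableSet,
    Measure.prod_apply_symm hs]
  -- Each vertical line meets the graph in a single point.
  refine (lintegral_congr fun y => ?_).trans lintegral_zero
  exact (measure_mono_null (fun r (hr : r = w y) => hr) Real.volume_singleton)

/-- Fubini's theorem in the coordinates `(x', xₙ)`. -/
lemma integral_eq_integral_horiz_vert {d : ℕ} {F : ℝ → EuclideanSpace ℝ (Fin d) → ℝ}
    (hF : Integrable (fun x : EuclideanSpace ℝ (Fin (d + 1)) => F (vert x) (horiz x))) :
    ∫ x : EuclideanSpace ℝ (Fin (d + 1)), F (vert x) (horiz x) = ∫ y, ∫ r, F r y := by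
  have h1 : (fun x : EuclideanSpace ℝ (Fin (d + 1)) => F (vert x) (horiz x))
      = (fun p : ℝ × EuclideanSpace ℝ (Fin d) => F p.1 p.2) ∘ splitLast d := by
    ext x; simp [splitLast_apply]
  have mp := measurePreserving_splitLast d
  have hi : Integrable (fun p : ℝ × EuclideanSpace ℝ (Fin d) => F p.1 p.2)
      (volume.prod volume) := by
    rw [h1] at hF
    exact (mp.integrable_comp_emb (splitLast d).measurableEmbedding).1 hF
  rw [← integral_prod_symm _ hi, h1, ← mp.integral_comp (splitLast d).measurableEmbedding]
  rfl

lemma integrable_integral_vert {d : ℕ} {F : ℝ → EuclideanSpace ℝ (Fin d) → ℝ}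
    (hF : Integrable (fun x : EuclideanSpace ℝ (Fin (d + 1)) => F (vert x) (horiz x))) :
    Integrable (fun y => ∫ r, F r y) := by
  have h1 : (fun x : EuclideanSpace ℝ (Fin (d + 1)) => F (vert x) (horiz x))
      = (fun p : ℝ × EuclideanSpace ℝ (Fin d) => F p.1 p.2) ∘ splitLast d := by
    ext x; simp [splitLast_apply]
  rw [h1] at hF
  exact (((measurePreserving_splitLast d).integrable_comp_emb
    (splitLast d).measurableEmbedding).1 hF).integral_prod_right

/-! ### Weak gradients and the transmission conditions. -/

section WeakGradient

variable {d : ℕ}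

lemma integral_eq_setIntegral_of_tsupport_subset {F : Type*} [NormedAddCommGroup F]
    [NormedSpace ℝ F] {X : Type*} [TopologicalSpace X] [MeasurableSpace X] {μ : Measure X}
    {S : Set X} {φ : X → ℝ} {f : X → F} (hφS : tsupport φ ⊆ S)
    (hf : ∀ x ∉ tsupport φ, f x = 0) : ∫ x in S, f x ∂μ = ∫ x, f x ∂μ :=
  setIntegral_eq_integral_of_forall_compl_eq_zero fun x hx => hf x fun h => hx (hφS h)

lemma fderiv_eq_zero_of_notMem_tsupport {φ : EuclideanSpace ℝ (Fin (d + 1)) → ℝ}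
    {x : EuclideanSpace ℝ (Fin (d + 1))} (hx : x ∉ tsupport φ) : fderiv ℝ φ x = 0 :=
  image_eq_zero_of_notMem_tsupport fun h => hx (tsupport_fderiv_subset ℝ h)

lemma gradient_eq_zero_of_notMem_tsupport {φ : EuclideanSpace ℝ (Fin (d + 1)) → ℝ}
    {x : EuclideanSpace ℝ (Fin (d + 1))} (hx : x ∉ tsupport φ) : gradient φ x = 0 := by
  simp [gradient, fderiv_eq_zero_of_notMem_tsupport hx]

lemma contDiff_fderiv_const {φ : EuclideanSpace ℝ (Fin (d + 1)) → ℝ} (hφ : ContDiff ℝ ∞ φ)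
    (z : EuclideanSpace ℝ (Fin (d + 1))) : ContDiff ℝ ∞ (fun x => fderiv ℝ φ x z) :=
  (hφ.fderiv_right (m := ∞) (by simp)).clm_apply contDiff_const

lemma tsupport_fderiv_const_subset {φ : EuclideanSpace ℝ (Fin (d + 1)) → ℝ}
    (z : EuclideanSpace ℝ (Fin (d + 1))) : tsupport (fun x => fderiv ℝ φ x z) ⊆ tsupport φ :=
  closure_minimal (fun x hx => by
    by_contra h
    exact hx (by simp [fderiv_eq_zero_of_notMem_tsupport h])) (isClosed_tsupport _)

lemma hasCompactSupport_fderiv_const {φ : EuclideanSpace ℝ (Fin (d + 1)) → ℝ}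
    (hφ : HasCompactSupport φ) (z : EuclideanSpace ℝ (Fin (d + 1))) :
    HasCompactSupport (fun x => fderiv ℝ φ x z) :=
  hφ.of_isClosed_subset (isClosed_tsupport _) (tsupport_fderiv_const_subset z)

lemma continuous_gradient {φ : EuclideanSpace ℝ (Fin (d + 1)) → ℝ} (hφ : ContDiff ℝ ∞ φ) :
    Continuous (gradient φ) :=
  (toDual ℝ _).symm.continuous.comp (hφ.continuous_fderiv (by simp))

lemma continuousOn_gradient {f : EuclideanSpace ℝ (Fin (d + 1)) → ℝ}
    {S : Set (EuclideanSpace ℝ (Fin (d + 1)))} (hS : IsOpen S) (hf : ContDiffOn ℝ 1 f S) :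
    ContinuousOn (gradient f) S :=
  (toDual ℝ _).symm.continuous.comp_continuousOn (hf.continuousOn_fderiv_of_isOpen hS le_rfl)

/-- A locally integrable factor is integrable on the compact support of the other, which is bounded.
The pairing `B` is left general to cover products, scalar multiples and inner products at once. -/
lemma MeasureTheory.LocallyIntegrableOn.integrable_of_compact_support {F G H : Type*}
    [NormedAddCommGroup F]
    [NormedAddCommGroup G] [NormedAddCommGroup H] [NormedSpace ℝ F] [NormedSpace ℝ G]
    [NormedSpace ℝ H]
    {S : Set (EuclideanSpace ℝ (Fin (d + 1)))}
    {f : EuclideanSpace ℝ (Fin (d + 1)) → F} {g : EuclideanSpace ℝ (Fin (d + 1)) → G}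
    (B : F →L[ℝ] G →L[ℝ] H)
    (hf : LocallyIntegrableOn f S) (hg : Continuous g) (hgc : HasCompactSupport g)
    (hgS : tsupport g ⊆ S) : Integrable (fun x => B (f x) (g x)) := by
  have h1 : IntegrableOn f (tsupport g) := hf.integrableOn_compact_subset hgS hgc
  obtain ⟨C, hC⟩ := hgc.exists_bound_of_continuous hg
  have h2 : IntegrableOn (fun x => B (f x) (g x)) (tsupport g) := by
    refine Integrable.mono' (h1.norm.const_mul (‖B‖ * C)) ?_ (Eventually.of_forall fun x => ?_)
    · exact B.aestronglyMeasurable_comp₂ h1.aestronglyMeasurable hg.aestronglyMeasurable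
    · calc ‖B (f x) (g x)‖ ≤ ‖B‖ * ‖f x‖ * ‖g x‖ := B.le_opNorm₂ _ _
        _ ≤ ‖B‖ * ‖f x‖ * C := by gcongr; exact hC x
        _ = ‖B‖ * C * ‖f x‖ := by ring
  refine (integrableOn_iff_integrable_of_support_subset fun x hx => ?_).1 h2
  by_contra h
  exact hx (by simp [image_eq_zero_of_notMem_tsupport h])

/-- Integration by parts against a test function supported where `f` is of class `C¹`. -/
lemma integral_mul_fderiv_test {f φ : EuclideanSpace ℝ (Fin (d + 1)) → ℝ}
    {S : Set (EuclideanSpace ℝ (Fin (d + 1)))} (hS : IsOpen S) (hf : ContDiffOn ℝ 1 f S)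
    (hφ : ContDiff ℝ ∞ φ) (hφc : HasCompactSupport φ) (hφS : tsupport φ ⊆ S)
    (z : EuclideanSpace ℝ (Fin (d + 1))) :
    ∫ x, f x * fderiv ℝ φ x z = -∫ x, fderiv ℝ f x z * φ x := by
  have hf0 : LocallyIntegrableOn f S := hf.continuousOn.locallyIntegrableOn hS.measurableSet
  have hf1 : LocallyIntegrableOn (fun x => fderiv ℝ f x z) S :=
    ((hf.continuousOn_fderiv_of_isOpen hS le_rfl).clm_apply
      continuousOn_const).locallyIntegrableOn hS.measurableSet
  refine integral_mul_fderiv_eq_neg_fderiv_mul_of_integrable ?_ ?_ ?_ ?_ ?_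
  · exact hf1.integrable_of_compact_support (ContinuousLinearMap.mul ℝ ℝ) hφ.continuous hφc hφS
  · exact hf0.integrable_of_compact_support (ContinuousLinearMap.mul ℝ ℝ)
      (contDiff_fderiv_const hφ z).continuous (hasCompactSupport_fderiv_const hφc z)
      ((tsupport_fderiv_const_subset z).trans hφS)
  · exact hf0.integrable_of_compact_support (ContinuousLinearMap.mul ℝ ℝ) hφ.continuous hφc hφS
  · intro x hx
    exact ((hf x (hφS hx)).contDiffAt (hS.mem_nhds (hφS hx))).differentiableAt (by simp)
  · intro x _
    exact hφ.differentiable (by simp) x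

/-- A vector identity is equivalent to its inner products with all `z`; the scalar form permits
using `∂_v φ` itself as a test function. -/
lemma isWeakGradient_iff_inner {u : EuclideanSpace ℝ (Fin (d + 1)) → ℝ}
    {G : EuclideanSpace ℝ (Fin (d + 1)) → EuclideanSpace ℝ (Fin (d + 1))}
    {S : Set (EuclideanSpace ℝ (Fin (d + 1)))}
    (hu : LocallyIntegrableOn u S) (hG : LocallyIntegrableOn G S) :
    IsWeakGradient S u G ↔ ∀ φ : EuclideanSpace ℝ (Fin (d + 1)) → ℝ, ContDiff ℝ ∞ φ →
      HasCompactSupport φ → tsupport φ ⊆ S → ∀ z,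
        ∫ x, u x * fderiv ℝ φ x z = -∫ x, φ x * inner ℝ (G x) z := by
  unfold IsWeakGradient
  refine forall_congr' fun φ => forall_congr' fun hφ => forall_congr' fun hφc =>
    forall_congr' fun hφS => ?_
  have e1 : ∫ x in S, u x • gradient φ x = ∫ x, u x • gradient φ x :=
    integral_eq_setIntegral_of_tsupport_subset hφS fun x hx => by
      simp [gradient_eq_zero_of_notMem_tsupport hx]
  have e2 : ∫ x in S, φ x • G x = ∫ x, φ x • G x :=
    integral_eq_setIntegral_of_tsupport_subset hφS fun x hx => by
      simp [image_eq_zero_of_notMem_tsupport hx]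
  have hsupp : tsupport (gradient φ) ⊆ tsupport φ := closure_minimal (fun x hx => by
    by_contra h
    exact hx (gradient_eq_zero_of_notMem_tsupport h)) (isClosed_tsupport _)
  have i1 : Integrable fun x => u x • gradient φ x :=
    hu.integrable_of_compact_support (ContinuousLinearMap.lsmul ℝ ℝ) (continuous_gradient hφ)
      (hφc.of_isClosed_subset (isClosed_tsupport _) hsupp) (hsupp.trans hφS)
  have i2 : Integrable fun x => φ x • G x :=
    hG.integrable_of_compact_support (ContinuousLinearMap.lsmul ℝ ℝ).flip hφ.continuous hφc hφS
  rw [e1, e2]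
  have k1 : ∀ z, ∫ x, u x * fderiv ℝ φ x z = inner ℝ z (∫ x, u x • gradient φ x) := fun z => by
    rw [← integral_inner i1]
    exact integral_congr_ae (Eventually.of_forall fun x => by
      simp [inner_smul_right, inner_gradient_right])
  have k2 : ∀ z, ∫ x, φ x * inner ℝ (G x) z = inner ℝ z (∫ x, φ x • G x) := fun z => by
    rw [← integral_inner i2]
    exact integral_congr_ae (Eventually.of_forall fun x => by
      simp [inner_smul_right, real_inner_comm])
  simp_rw [k1, k2, ← inner_neg_right]
  exact ⟨fun h z => by rw [h], fun h => ext_inner_left ℝ h⟩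

lemma isWeakGradient_gradient {f : EuclideanSpace ℝ (Fin (d + 1)) → ℝ}
    {S : Set (EuclideanSpace ℝ (Fin (d + 1)))} (hS : IsOpen S) (hf : ContDiffOn ℝ 1 f S) :
    IsWeakGradient S f (gradient f) := by
  rw [isWeakGradient_iff_inner (hf.continuousOn.locallyIntegrableOn hS.measurableSet)
    ((continuousOn_gradient hS hf).locallyIntegrableOn hS.measurableSet)]
  intro φ hφ hφc hφS z
  rw [integral_mul_fderiv_test hS hf hφ hφc hφS]
  simp [inner_gradient_left, mul_comm]

lemma IsWeakGradient.mono {u : EuclideanSpace ℝ (Fin (d + 1)) → ℝ}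
    {G : EuclideanSpace ℝ (Fin (d + 1)) → EuclideanSpace ℝ (Fin (d + 1))}
    {S T : Set (EuclideanSpace ℝ (Fin (d + 1)))} (h : IsWeakGradient T u G) (hST : S ⊆ T) :
    IsWeakGradient S u G := by
  intro φ hφ hφc hφS
  have e1 : ∀ x ∉ tsupport φ, u x • gradient φ x = 0 := fun x hx => by
    simp [gradient_eq_zero_of_notMem_tsupport hx]
  have e2 : ∀ x ∉ tsupport φ, φ x • G x = 0 := fun x hx => by
    simp [image_eq_zero_of_notMem_tsupport hx]
  have := h φ hφ hφc (hφS.trans hST)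
  rwa [integral_eq_setIntegral_of_tsupport_subset (hφS.trans hST) e1,
    integral_eq_setIntegral_of_tsupport_subset (hφS.trans hST) e2,
    ← integral_eq_setIntegral_of_tsupport_subset hφS e1,
    ← integral_eq_setIntegral_of_tsupport_subset hφS e2] at this

/-- By the fundamental lemma of the calculus of variations. This identifies the weak gradient of `u`
with the classical gradients on either side of `∂D`. -/
lemma IsWeakGradient.ae_eq {u : EuclideanSpace ℝ (Fin (d + 1)) → ℝ}
    {G H : EuclideanSpace ℝ (Fin (d + 1)) → EuclideanSpace ℝ (Fin (d + 1))}
    {S : Set (EuclideanSpace ℝ (Fin (d + 1)))} (hS : IsOpen S) (hG : LocallyIntegrableOn G S)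
    (hH : LocallyIntegrableOn H S) (h1 : IsWeakGradient S u G) (h2 : IsWeakGradient S u H) :
    ∀ᵐ x, x ∈ S → G x = H x := by
  have := hS.ae_eq_zero_of_integral_contDiff_smul_eq_zero (hG.sub hH) fun φ hφ hφc hφS => by
    have i1 : Integrable fun x => φ x • G x :=
      hG.integrable_of_compact_support (ContinuousLinearMap.lsmul ℝ ℝ).flip hφ.continuous hφc hφS
    have i2 : Integrable fun x => φ x • H x :=
      hH.integrable_of_compact_support (ContinuousLinearMap.lsmul ℝ ℝ).flip hφ.continuous hφc hφS
    have e1 := integral_eq_setIntegral_of_tsupport_subset (μ := volume) (f := fun x => φ x • G x)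
      hφS fun x hx => by simp [image_eq_zero_of_notMem_tsupport hx]
    have e2 := integral_eq_setIntegral_of_tsupport_subset (μ := volume) (f := fun x => φ x • H x)
      hφS fun x hx => by simp [image_eq_zero_of_notMem_tsupport hx]
    simp only [Pi.sub_apply, smul_sub]
    rw [integral_sub i1 i2, ← e1, ← e2, sub_eq_zero, ← neg_inj]
    exact (h1 φ hφ hφc hφS).symm.trans (h2 φ hφ hφc hφS)
  filter_upwards [this] with x hx hxS
  exact sub_eq_zero.1 (hx hxS)

/-- A weak gradient is weakly curl-free. -/
lemma IsWeakGradient.integral_curl_eq_zero {u : EuclideanSpace ℝ (Fin (d + 1)) → ℝ}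
    {G : EuclideanSpace ℝ (Fin (d + 1)) → EuclideanSpace ℝ (Fin (d + 1))}
    {S : Set (EuclideanSpace ℝ (Fin (d + 1)))} (hu : LocallyIntegrableOn u S)
    (hG : LocallyIntegrableOn G S) (h : IsWeakGradient S u G)
    {φ : EuclideanSpace ℝ (Fin (d + 1)) → ℝ} (hφ : ContDiff ℝ ∞ φ) (hφc : HasCompactSupport φ)
    (hφS : tsupport φ ⊆ S) (v z : EuclideanSpace ℝ (Fin (d + 1))) :
    ∫ x, inner ℝ (G x) (fderiv ℝ φ x v • z - fderiv ℝ φ x z • v) = 0 := by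
  rw [isWeakGradient_iff_inner hu hG] at h
  have key : ∀ v z : EuclideanSpace ℝ (Fin (d + 1)),
      ∫ x, u x * fderiv ℝ (fun y => fderiv ℝ φ y v) x z
        = -∫ x, fderiv ℝ φ x v * inner ℝ (G x) z := fun v z =>
    h _ (contDiff_fderiv_const hφ v) (hasCompactSupport_fderiv_const hφc v)
      ((tsupport_fderiv_const_subset v).trans hφS) z
  have int : ∀ v z : EuclideanSpace ℝ (Fin (d + 1)),
      Integrable fun x => fderiv ℝ φ x v * inner ℝ (G x) z := fun v z => by
    have := (hG.integrable_of_compact_support (ContinuousLinearMap.lsmul ℝ ℝ).flip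
      (contDiff_fderiv_const hφ v).continuous (hasCompactSupport_fderiv_const hφc v)
      ((tsupport_fderiv_const_subset v).trans hφS)).inner_const (𝕜 := ℝ) z
    simpa [inner_smul_left] using this
  -- Symmetry of second derivatives: both halves of the curl are the integral of `u` against the
  -- same mixed derivative of `φ`.
  have symm : ∀ x, fderiv ℝ (fun y => fderiv ℝ φ y v) x z
      = fderiv ℝ (fun y => fderiv ℝ φ y z) x v := fun x => by
    have hd : DifferentiableAt ℝ (fderiv ℝ φ) x :=
      (hφ.fderiv_right (m := ∞) (by simp)).differentiable (by simp) x
    have hs : IsSymmSndFDerivAt ℝ φ x := hφ.contDiffAt.isSymmSndFDerivAt (by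
      rw [minSmoothness_of_isRCLikeNormedField]
      exact WithTop.coe_le_coe.2 le_top)
    rw [fderiv_clm_apply hd (differentiableAt_const v),
      fderiv_clm_apply hd (differentiableAt_const z)]
    simpa using hs z v
  simp only [inner_sub_right, inner_smul_right]
  rw [integral_sub (int v z) (int z v), sub_eq_zero, ← neg_inj, ← key, ← key]
  simp_rw [symm]

/-- A harmonic function is weakly harmonic. -/
lemma integral_inner_gradient_of_harmonic {f φ : EuclideanSpace ℝ (Fin (d + 1)) → ℝ}
    {S : Set (EuclideanSpace ℝ (Fin (d + 1)))} (hS : IsOpen S) (hf : HarmonicOnNhd f S)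
    (hφ : ContDiff ℝ ∞ φ) (hφc : HasCompactSupport φ) (hφS : tsupport φ ⊆ S) :
    ∫ x, inner ℝ (gradient f x) (gradient φ x) = 0 := by
  have hf2 := hf.contDiffOn
  let b := EuclideanSpace.basisFun (Fin (d + 1)) ℝ
  have hfd : ContDiffOn ℝ 1 (fderiv ℝ f) S := hf2.fderiv_of_isOpen hS (by norm_num)
  have hfi : ∀ i, ContDiffOn ℝ 1 (fun x => fderiv ℝ f x (b i)) S := fun i =>
    hfd.clm_apply contDiffOn_const
  have e : ∀ x, inner ℝ (gradient f x) (gradient φ x)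
      = ∑ i, fderiv ℝ f x (b i) * fderiv ℝ φ x (b i) := fun x => by
    rw [← b.sum_inner_mul_inner]
    simp [inner_gradient_left, inner_gradient_right]
  have i1 : ∀ i, Integrable fun x => fderiv ℝ f x (b i) * fderiv ℝ φ x (b i) := fun i =>
    ((hfi i).continuousOn.locallyIntegrableOn hS.measurableSet).integrable_of_compact_support
      (ContinuousLinearMap.mul ℝ ℝ)
      (contDiff_fderiv_const hφ _).continuous (hasCompactSupport_fderiv_const hφc _)
      ((tsupport_fderiv_const_subset _).trans hφS)
  have i2 : ∀ i, Integrable fun x => fderiv ℝ (fun y => fderiv ℝ f y (b i)) x (b i) * φ x :=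
    fun i => ((((hfi i).continuousOn_fderiv_of_isOpen hS le_rfl).clm_apply
      continuousOn_const).locallyIntegrableOn hS.measurableSet).integrable_of_compact_support
      (ContinuousLinearMap.mul ℝ ℝ) hφ.continuous hφc hφS
  simp_rw [e]
  rw [integral_finsetSum _ fun i _ => i1 i]
  simp_rw [fun i => integral_mul_fderiv_test hS (hfi i) hφ hφc hφS (b i)]
  rw [Finset.sum_neg_distrib, ← integral_finsetSum _ fun i _ => i2 i, neg_eq_zero]
  refine (integral_congr_ae (Eventually.of_forall fun x => ?_)).trans (integral_zero _ _)
  by_cases hx : x ∈ tsupport φ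
  · have hd : DifferentiableAt ℝ (fderiv ℝ f) x :=
      ((hfd x (hφS hx)).contDiffAt (hS.mem_nhds (hφS hx))).differentiableAt (by simp)
    have hL := (hf x (hφS hx)).2.self_of_nhds
    rw [laplacian_eq_iteratedFDeriv_orthonormalBasis f b] at hL
    simp only [Pi.zero_apply] at hL
    simp only [← Finset.sum_mul]
    have : ∑ i, fderiv ℝ (fun y => fderiv ℝ f y (b i)) x (b i) = 0 := by
      rw [← hL]
      refine Finset.sum_congr rfl fun i _ => ?_
      rw [fderiv_clm_apply hd (differentiableAt_const _), iteratedFDeriv_two_apply]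
      simp
    simp [this]
  · simp [image_eq_zero_of_notMem_tsupport hx]

/-- Testing the equation across the interface, after subtracting the exterior function. -/
lemma integral_interior_of_weak {Ω D U : Set (EuclideanSpace ℝ (Fin (d + 1)))}
    {a e G L : EuclideanSpace ℝ (Fin (d + 1)) → EuclideanSpace ℝ (Fin (d + 1))} {c : ℝ}
    (hD : IsOpen D) (hU : IsOpen U) (hUΩ : U ⊆ Ω)
    (hnull : volume (U ∩ frontier D) = 0) (hG : LocallyIntegrableOn G Ω)
    (he : LocallyIntegrableOn e U)
    (hGa : ∀ᵐ x, x ∈ D → G x = a x) (hGe : ∀ᵐ x, x ∈ U \ closure D → G x = e x)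
    (hL : Continuous L) (hLc : HasCompactSupport L) (hLU : tsupport L ⊆ U)
    (h1 : ∫ x in Ω, conductivity c D x * inner ℝ (G x) (L x) = 0)
    (h2 : ∫ x, inner ℝ (e x) (L x) = 0) :
    ∫ x in U ∩ D, inner ℝ (c • a x - e x) (L x) = 0 := by
  have hL0 : ∀ x ∉ U, L x = 0 := fun x hx => image_eq_zero_of_notMem_tsupport fun h => hx (hLU h)
  have i1 : Integrable fun x => inner ℝ (G x) (L x) :=
    hG.integrable_of_compact_support (innerSL ℝ) hL hLc (hLU.trans hUΩ)
  have i2 : Integrable fun x => inner ℝ (e x) (L x) :=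
    he.integrable_of_compact_support (innerSL ℝ) hL hLc hLU
  have i1' : Integrable fun x => conductivity c D x * inner ℝ (G x) (L x) := by
    have : (fun x => conductivity c D x * inner ℝ (G x) (L x)) = fun x =>
        inner ℝ (G x) (L x) + (c - 1) * D.indicator (fun x => inner ℝ (G x) (L x)) x := by
      ext x
      by_cases hx : x ∈ D <;> simp [conductivity, hx]
      ring
    rw [this]
    exact i1.add ((i1.indicator hD.measurableSet).const_mul _)
  rw [setIntegral_eq_integral_of_forall_compl_eq_zero
    (fun x hx => by simp [hL0 x fun h => hx (hUΩ h)])] at h1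
  rw [← integral_indicator (hU.inter hD).measurableSet, ← sub_zero (0 : ℝ)]
  nth_rw 1 [← h1]
  rw [← h2, ← integral_sub i1' i2]
  -- The difference of the integrands is `(c a - e) · L` in `U ∩ D`, zero in `U` off `closure D`
  -- since there `G = e` and the conductivity is `1`, and zero off `U`. The interface is null.
  refine integral_congr_ae ?_
  have hn : ∀ᵐ x, x ∉ U ∩ frontier D := measure_eq_zero_iff_ae_notMem.1 hnull
  filter_upwards [hGa, hGe, hn] with x h3 h4 h5
  by_cases hxU : x ∈ U
  · by_cases hxD : x ∈ D
    · simp [hxU, hxD, conductivity, h3 hxD, inner_sub_left, inner_smul_left]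
    · have hcl : x ∉ closure D := fun h => h5 ⟨hxU, h, by rwa [hD.interior_eq]⟩
      simp [hxD, conductivity, h4 ⟨hxU, hcl⟩]
  · simp [hxU, hL0 x hxU]

/-- The transmission conditions on `∂D ∩ U`, in weak form. -/
lemma IsConductivitySolution.transmission {Ω D U : Set (EuclideanSpace ℝ (Fin (d + 1)))} {η : ℝ}
    {u ui ue : EuclideanSpace ℝ (Fin (d + 1)) → ℝ} (hu : IsConductivitySolution Ω D η u)
    (hΩ : IsOpen Ω) (hD : IsOpen D) (hU : IsOpen U) (hUΩ : U ⊆ Ω) (hDΩ : D ⊆ Ω)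
    (hnull : volume (U ∩ frontier D) = 0)
    (hui : HarmonicOnNhd ui D) (huiu : ui =ᵐ[volume.restrict D] u)
    (hue : HarmonicOnNhd ue ((Ω \ closure D) ∪ U))
    (hueu : ue =ᵐ[volume.restrict (Ω \ closure D)] u)
    {φ : EuclideanSpace ℝ (Fin (d + 1)) → ℝ} (hφ : ContDiff ℝ ∞ φ) (hφc : HasCompactSupport φ)
    (hφU : tsupport φ ⊆ U) :
    (∫ x in U ∩ D, inner ℝ (η • gradient ui x - gradient ue x) (gradient φ x) = 0) ∧
    ∀ v z, ∫ x in U ∩ D, inner ℝ (gradient ui x - gradient ue x)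
      (fderiv ℝ φ x v • z - fderiv ℝ φ x z • v) = 0 := by
  obtain ⟨hu2, G, hG2, hGw, hsol⟩ := hu
  have huL : LocallyIntegrableOn u Ω :=
    locallyIntegrableOn_of_locallyIntegrable_restrict (hu2.locallyIntegrable (by norm_num))
  have hGL : LocallyIntegrableOn G Ω :=
    locallyIntegrableOn_of_locallyIntegrable_restrict (hG2.locallyIntegrable (by norm_num))
  have hE : IsOpen (Ω \ closure D) := hΩ.sdiff isClosed_closure
  have C1 : ∀ {f : EuclideanSpace ℝ (Fin (d + 1)) → ℝ} {S}, HarmonicOnNhd f S →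
      ContDiffOn ℝ 1 f S := fun h => h.contDiffOn.of_le (by norm_num)
  have ident : ∀ {f : EuclideanSpace ℝ (Fin (d + 1)) → ℝ} {S}, IsOpen S → S ⊆ Ω →
      HarmonicOnNhd f S → f =ᵐ[volume.restrict S] u → ∀ᵐ x, x ∈ S → G x = gradient f x := by
    intro f S hS hSΩ hf hfu
    refine IsWeakGradient.ae_eq hS (hGL.mono_set hSΩ) ((continuousOn_gradient hS
      (C1 hf)).locallyIntegrableOn hS.measurableSet) (hGw.mono hSΩ) ?_
    intro φ hφ hφc hφS
    rw [← isWeakGradient_gradient hS (C1 hf) φ hφ hφc hφS]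
    refine integral_congr_ae ?_
    filter_upwards [hfu] with x hx
    rw [hx]
  have hGa := ident hD hDΩ hui huiu
  have hGe := ident hE sdiff_subset (hue.mono subset_union_left) hueu
  have hGe' : ∀ᵐ x, x ∈ U \ closure D → G x = gradient ue x := by
    filter_upwards [hGe] with x hx hxU using hx ⟨hUΩ hxU.1, hxU.2⟩
  have hueU : HarmonicOnNhd ue U := hue.mono subset_union_right
  have heL : LocallyIntegrableOn (gradient ue) U :=
    (continuousOn_gradient hU (C1 hueU)).locallyIntegrableOn hU.measurableSet
  have supp : ∀ {L : EuclideanSpace ℝ (Fin (d + 1)) → EuclideanSpace ℝ (Fin (d + 1))},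
      (∀ x ∉ tsupport φ, L x = 0) → tsupport L ⊆ tsupport φ := fun h =>
    closure_minimal (fun x hx => by
      by_contra h'
      exact hx (h x h')) (isClosed_tsupport _)
  have s1 := supp fun x hx => gradient_eq_zero_of_notMem_tsupport (φ := φ) hx
  refine ⟨integral_interior_of_weak hD hU hUΩ hnull hGL heL hGa hGe' (continuous_gradient hφ)
    (hφc.of_isClosed_subset (isClosed_tsupport _) s1) (s1.trans hφU)
    (hsol φ hφ hφc (hφU.trans hUΩ)) (integral_inner_gradient_of_harmonic hU hueU hφ hφc hφU), ?_⟩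
  intro v z
  have s2 := supp (L := fun x => fderiv ℝ φ x v • z - fderiv ℝ φ x z • v) fun x hx => by
    simp [fderiv_eq_zero_of_notMem_tsupport hx]
  -- Conductivity `1` here: the curl identity for `G` holds without the weight, so the same
  -- subtraction yields `a - e` instead of `η a - e`.
  have := integral_interior_of_weak (c := 1) hD hU hUΩ hnull hGL heL hGa hGe'
    (((contDiff_fderiv_const hφ v).continuous.smul continuous_const).sub
      ((contDiff_fderiv_const hφ z).continuous.smul continuous_const))
    (hφc.of_isClosed_subset (isClosed_tsupport _) s2) (s2.trans hφU) ?_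
    (IsWeakGradient.integral_curl_eq_zero
      ((C1 hueU).continuousOn.locallyIntegrableOn hU.measurableSet) heL
      (isWeakGradient_gradient hU (C1 hueU)) hφ hφc hφU v z)
  · simpa using this
  · have h0 := hGw.integral_curl_eq_zero huL hGL hφ hφc (hφU.trans hUΩ) v z
    rw [← h0, setIntegral_eq_integral_of_forall_compl_eq_zero]
    · simp [conductivity]
    · intro x hx
      have : x ∉ tsupport φ := fun h => hx (hUΩ (hφU h))
      simp [fderiv_eq_zero_of_notMem_tsupport this]

end WeakGradient

/-! ### The oscillatory integral over the tip. -/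

section Oscillatory

variable {d : ℕ}

lemma integrable_exp_neg_mul_norm_sq {b : ℝ} (hb : 0 < b) :
    Integrable fun y : EuclideanSpace ℝ (Fin d) => Real.exp (-b * ‖y‖ ^ 2) := by
  have := (GaussianFourier.integrable_cexp_neg_mul_sq_norm_add (V := EuclideanSpace ℝ (Fin d))
    (b := (b : ℂ)) (by simpa using hb) 0 0).norm
  refine this.congr (Eventually.of_forall fun y => ?_)
  simp only [Complex.norm_exp]
  norm_cast
  simp

lemma integral_exp_neg_mul_norm_sq {b : ℝ} (hb : 0 < b) :
    ∫ y : EuclideanSpace ℝ (Fin d), Real.exp (-b * ‖y‖ ^ 2) = (Real.pi / b) ^ ((d : ℝ) / 2) := by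
  rw [GaussianFourier.integral_rexp_neg_mul_sq_norm hb]
  simp

/-- Real part of the Fourier transform of a Gaussian. With `b = τ K` the exponent becomes `-τ /
(4K)`. -/
lemma integral_cos_mul_exp_neg_mul_norm_sq {b τ : ℝ} (hb : 0 < b) {v : EuclideanSpace ℝ (Fin d)}
    (hv : ‖v‖ = 1) :
    ∫ y : EuclideanSpace ℝ (Fin d), Real.cos (τ * inner ℝ v y) * Real.exp (-b * ‖y‖ ^ 2)
      = (Real.pi / b) ^ ((d : ℝ) / 2) * Real.exp (-(τ ^ 2 / (4 * b))) := by
  have hb' : 0 < (b : ℂ).re := by simpa using hb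
  have h1 := GaussianFourier.integral_cexp_neg_mul_sq_norm_add (V := EuclideanSpace ℝ (Fin d))
    hb' (τ * Complex.I) v
  have h2 := GaussianFourier.integrable_cexp_neg_mul_sq_norm_add (V := EuclideanSpace ℝ (Fin d))
    hb' (τ * Complex.I) v
  have h3 : ∀ y : EuclideanSpace ℝ (Fin d), Real.cos (τ * inner ℝ v y) * Real.exp (-b * ‖y‖ ^ 2)
      = RCLike.re (Complex.exp (-(b : ℂ) * (‖y‖ : ℂ) ^ 2 + τ * Complex.I * (inner ℝ v y : ℝ))) := by
    intro y
    rw [RCLike.re_eq_complex_re, Complex.exp_re]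
    have e1 : (-(b : ℂ) * (‖y‖ : ℂ) ^ 2 + τ * Complex.I * (inner ℝ v y : ℝ))
        = ((-b * ‖y‖ ^ 2 : ℝ) : ℂ) + ((τ * inner ℝ v y : ℝ) : ℂ) * Complex.I := by
      push_cast; ring
    rw [e1]
    simp only [Complex.add_re, Complex.add_im, Complex.ofReal_re, Complex.ofReal_im,
      Complex.re_ofReal_mul, Complex.im_ofReal_mul, Complex.I_re, Complex.I_im]
    simp [mul_comm]
  simp_rw [h3]
  rw [integral_re h2, h1, hv, RCLike.re_eq_complex_re]
  have e2 : ((Real.pi : ℂ) / b) ^ ((Module.finrank ℝ (EuclideanSpace ℝ (Fin d)) : ℂ) / 2) *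
      Complex.exp ((τ * Complex.I) ^ 2 * ((1 : ℝ) : ℂ) ^ 2 / (4 * b))
      = (((Real.pi / b) ^ ((d : ℝ) / 2) * Real.exp (-(τ ^ 2 / (4 * b))) : ℝ) : ℂ) := by
    rw [Complex.ofReal_mul, Complex.ofReal_cpow (by positivity)]
    push_cast
    rw [finrank_euclideanSpace_fin, mul_pow, Complex.I_sq]
    congr 2
    ring
  rw [e2, Complex.ofReal_re]

/-- The truncated Laplace integral over a half line. -/
lemma abs_exp_div_sub_integral_cutoff_le {τ h s : ℝ} (hτ : 0 < τ) {ψ : ℝ → ℝ} (hψ : Measurable ψ)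
    (h0 : ∀ r, 0 ≤ ψ r) (h1 : ∀ r, ψ r ≤ 1) (hone : ∀ r ≤ h - 1 / τ, ψ r = 1) :
    |(∫ r in Ioi s, ψ r * Real.exp (-τ * r)) - Real.exp (-τ * s) / τ|
      ≤ Real.exp ((1 - τ * h) / 2) * Real.exp (-(τ * s / 2)) / τ := by
  have hI : ∀ c, IntegrableOn (fun r => Real.exp (-τ * r)) (Ioi c) := fun c =>
    integrableOn_exp_mul_Ioi (by linarith) c
  have hE : ∀ c, ∫ r in Ioi c, Real.exp (-τ * r) = Real.exp (-τ * c) / τ := fun c => by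
    rw [integral_exp_mul_Ioi (by linarith)]
    field_simp
  -- The cutoff differs from `1` only above `h - 1 / τ`, so the error is at most the tail beyond
  -- `c`.
  set c := max s (h - 1 / τ) with hc
  have hψI : IntegrableOn (fun r => ψ r * Real.exp (-τ * r)) (Ioi s) := by
    refine (hI s).mono' (by fun_prop) (Eventually.of_forall fun r => ?_)
    rw [Real.norm_eq_abs, abs_of_nonneg (mul_nonneg (h0 r) (Real.exp_pos _).le)]
    exact mul_le_of_le_one_left (Real.exp_pos _).le (h1 r)
  rw [← hE s, ← integral_sub hψI (hI s), ← Real.norm_eq_abs]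
  have hle : ‖∫ r in Ioi s, (ψ r * Real.exp (-τ * r) - Real.exp (-τ * r))‖
      ≤ ∫ r in Ioi s, (Ioi c).indicator (fun r => Real.exp (-τ * r)) r := by
    refine norm_integral_le_of_norm_le ((hI s).integrable.indicator measurableSet_Ioi) ?_
    have hne : ∀ᵐ r ∂(volume.restrict (Ioi s)), r ≠ c :=
      ae_restrict_of_ae (measure_eq_zero_iff_ae_notMem.1 Real.volume_singleton)
    filter_upwards [ae_restrict_mem measurableSet_Ioi, hne] with r hr hrc
    by_cases hr2 : r ≤ h - 1 / τ
    · rw [hone r hr2, one_mul, sub_self, norm_zero]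
      exact indicator_nonneg (fun _ _ => (Real.exp_pos _).le) _
    · have : r ∈ Ioi c := max_lt hr (not_le.1 hr2)
      rw [indicator_of_mem this, Real.norm_eq_abs, abs_le]
      have := Real.exp_pos (-τ * r)
      constructor <;> nlinarith [h0 r, h1 r]
  refine hle.trans ?_
  rw [setIntegral_indicator measurableSet_Ioi, Ioi_inter_Ioi, sup_eq_right.2 (le_max_left _ _),
    hE c, ← Real.exp_add]
  gcongr
  -- The maximum `c` is at least the mean of its two arguments; this keeps half of the decay in `s`,
  -- which remains integrable when `s = w y`.
  have a1 : s ≤ c := le_max_left _ _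
  have a2 : h - 1 / τ ≤ c := le_max_right _ _
  have a3 : τ * (h - 1 / τ) = τ * h - 1 := by field_simp
  nlinarith [mul_le_mul_of_nonneg_left a1 hτ.le, mul_le_mul_of_nonneg_left a2 hτ.le]

/-- The oscillatory integral over a region pinched between two paraboloids is close to the one over
a paraboloid. -/
lemma abs_integral_cos_sub_le {w : EuclideanSpace ℝ (Fin d) → ℝ} (hw : Measurable w)
    {Km K Kp τ h : ℝ} (hKm : 0 < Km) (hmK : Km ≤ K) (hKp : K ≤ Kp)
    (hwm : ∀ y, Km * ‖y‖ ^ 2 ≤ w y) (hwp : ∀ y, w y ≤ Kp * ‖y‖ ^ 2) (hτ : 0 < τ)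
    {ψ : ℝ → ℝ} (hψ : Measurable ψ) (h0 : ∀ r, 0 ≤ ψ r) (h1 : ∀ r, ψ r ≤ 1)
    (hone : ∀ r ≤ h - 1 / τ, ψ r = 1) (hzero : ∀ r, h ≤ r → ψ r = 0)
    {v : EuclideanSpace ℝ (Fin d)} (hv : ‖v‖ = 1)
    {S : Set (EuclideanSpace ℝ (Fin (d + 1)))}
    (hS : S = {x | w (horiz x) < vert x ∧ vert x < h}) (hSfin : volume S ≠ ⊤) :
    |(∫ x in S, ψ (vert x) * Real.exp (-τ * vert x) * Real.cos (τ * inner ℝ v (horiz x)))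
      - (Real.pi / (τ * K)) ^ ((d : ℝ) / 2) * Real.exp (-(τ / (4 * K))) / τ|
      ≤ ((Real.pi / (τ * Km)) ^ ((d : ℝ) / 2) - (Real.pi / (τ * Kp)) ^ ((d : ℝ) / 2)) / τ
        + Real.exp ((1 - τ * h) / 2) * (2 * Real.pi / (τ * Km)) ^ ((d : ℝ) / 2) / τ := by
  have hK : 0 < K := hKm.trans_le hmK
  have hKp0 : 0 < Kp := hK.trans_le hKp
  have hSm : MeasurableSet S := by
    rw [hS]
    exact (measurableSet_lt (hw.comp continuous_horiz.measurable) continuous_vert.measurable).inter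
      (measurableSet_lt continuous_vert.measurable measurable_const)
  let F : ℝ → EuclideanSpace ℝ (Fin d) → ℝ := fun r y =>
    (Ioi (w y)).indicator (fun r => ψ r * Real.exp (-τ * r)) r * Real.cos (τ * inner ℝ v y)
  have hw0 : ∀ y, 0 ≤ w y := fun y => le_trans (by positivity) (hwm y)
  have hFS : (fun x : EuclideanSpace ℝ (Fin (d + 1)) => F (vert x) (horiz x))
      = S.indicator (fun x => ψ (vert x) * Real.exp (-τ * vert x) *
          Real.cos (τ * inner ℝ v (horiz x))) := by
    ext x
    by_cases hx : w (horiz x) < vert x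
    · by_cases hx2 : vert x < h
      · have : x ∈ S := by rw [hS]; exact ⟨hx, hx2⟩
        simp [F, hx, this]
      · have : x ∉ S := by rw [hS]; exact fun h => hx2 h.2
        simp [F, this, hzero _ (not_lt.1 hx2)]
    · have : x ∉ S := by rw [hS]; exact fun h => hx h.1
      simp [F, hx, this]
  have hFi : Integrable (fun x : EuclideanSpace ℝ (Fin (d + 1)) => F (vert x) (horiz x)) := by
    rw [hFS, integrable_indicator_iff hSm]
    have m1 := (continuous_vert (d := d)).measurable
    have m2 := (continuous_horiz (d := d)).measurable
    refine IntegrableOn.of_bound hSfin.lt_top (by fun_prop) 1 ?_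
    filter_upwards [ae_restrict_mem hSm] with x hx
    rw [hS] at hx
    have : 0 ≤ vert x := (hw0 _).trans hx.1.le
    have e1 : Real.exp (-τ * vert x) ≤ 1 := Real.exp_le_one_iff.2 (by nlinarith)
    rw [norm_mul, norm_mul, Real.norm_eq_abs, Real.norm_eq_abs, Real.norm_eq_abs,
      abs_of_nonneg (h0 _), abs_of_pos (Real.exp_pos _)]
    calc _ ≤ 1 * 1 * (1 : ℝ) := by
          gcongr
          · exact h1 _
          · exact Real.abs_cos_le_one _
      _ = 1 := by norm_num
  rw [← integral_indicator hSm, ← hFS, integral_eq_integral_horiz_vert hFi]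
  have hinner := integrable_integral_vert hFi
  have hG : ∀ b : ℝ, 0 < b → Integrable fun y : EuclideanSpace ℝ (Fin d) =>
    Real.exp (-b * ‖y‖ ^ 2) := fun b hb => integrable_exp_neg_mul_norm_sq hb
  have hmain : Integrable fun y : EuclideanSpace ℝ (Fin d) =>
      Real.cos (τ * inner ℝ v y) * Real.exp (-(τ * K) * ‖y‖ ^ 2) / τ := by
    refine Integrable.div_const ?_ _
    refine (hG _ (mul_pos hτ hK)).mono' (by fun_prop) (Eventually.of_forall fun y => ?_)
    rw [norm_mul, Real.norm_eq_abs, Real.norm_eq_abs, abs_of_pos (Real.exp_pos _)]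
    exact mul_le_of_le_one_left (Real.exp_pos _).le (Real.abs_cos_le_one _)
  have hmainv : (Real.pi / (τ * K)) ^ ((d : ℝ) / 2) * Real.exp (-(τ / (4 * K))) / τ
      = ∫ y : EuclideanSpace ℝ (Fin d),
        Real.cos (τ * inner ℝ v y) * Real.exp (-(τ * K) * ‖y‖ ^ 2) / τ := by
    rw [integral_div, integral_cos_mul_exp_neg_mul_norm_sq (mul_pos hτ hK) hv]
    congr 4
    field_simp
  rw [hmainv, ← integral_sub hinner hmain, ← Real.norm_eq_abs]
  have hbd : Integrable fun y : EuclideanSpace ℝ (Fin d) =>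
      (Real.exp (-(τ * Km) * ‖y‖ ^ 2) - Real.exp (-(τ * Kp) * ‖y‖ ^ 2)) / τ
        + Real.exp ((1 - τ * h) / 2) * Real.exp (-(τ * Km / 2) * ‖y‖ ^ 2) / τ :=
    (((hG _ (mul_pos hτ hKm)).sub (hG _ (mul_pos hτ hKp0))).div_const _).add
      (((hG _ (half_pos (mul_pos hτ hKm))).const_mul _).div_const _)
  refine (norm_integral_le_of_norm_le hbd (Eventually.of_forall fun y => ?_)).trans (le_of_eq ?_)
  · have e1 : ∫ r, F r y
        = (∫ r in Ioi (w y), ψ r * Real.exp (-τ * r)) * Real.cos (τ * inner ℝ v y) := by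
      simp only [F]
      rw [integral_mul_const, integral_indicator measurableSet_Ioi]
    have e2 := abs_exp_div_sub_integral_cutoff_le (s := w y) hτ hψ h0 h1 hone
    rw [e1]
    set I := ∫ r in Ioi (w y), ψ r * Real.exp (-τ * r)
    have hcos := Real.abs_cos_le_one (τ * inner ℝ v y)
    set c := Real.cos (τ * inner ℝ v y)
    have m1 : Real.exp (-(τ * w y / 2)) ≤ Real.exp (-(τ * Km / 2) * ‖y‖ ^ 2) :=
      Real.exp_le_exp.2 (by nlinarith [mul_le_mul_of_nonneg_left (hwm y) hτ.le])
    have m2 : Real.exp (-τ * w y) ≤ Real.exp (-(τ * Km) * ‖y‖ ^ 2) :=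
      Real.exp_le_exp.2 (by nlinarith [mul_le_mul_of_nonneg_left (hwm y) hτ.le])
    have m3 : Real.exp (-(τ * Kp) * ‖y‖ ^ 2) ≤ Real.exp (-τ * w y) :=
      Real.exp_le_exp.2 (by nlinarith [mul_le_mul_of_nonneg_left (hwp y) hτ.le])
    have m4 : Real.exp (-(τ * K) * ‖y‖ ^ 2) ≤ Real.exp (-(τ * Km) * ‖y‖ ^ 2) :=
      Real.exp_le_exp.2 (by
        nlinarith [mul_le_mul_of_nonneg_left hmK (mul_nonneg hτ.le (sq_nonneg ‖y‖))])
    have m5 : Real.exp (-(τ * Kp) * ‖y‖ ^ 2) ≤ Real.exp (-(τ * K) * ‖y‖ ^ 2) :=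
      Real.exp_le_exp.2 (by
        nlinarith [mul_le_mul_of_nonneg_left hKp (mul_nonneg hτ.le (sq_nonneg ‖y‖))])
    -- Inserting `exp (-τ w) / τ` separates the cutoff error from the shape error. In the latter
    -- both exponentials lie between the Gaussians of `Kp` and `Km`.
    have e3 : I * c - c * Real.exp (-(τ * K) * ‖y‖ ^ 2) / τ
        = c * ((I - Real.exp (-τ * w y) / τ)
          + (Real.exp (-τ * w y) - Real.exp (-(τ * K) * ‖y‖ ^ 2)) / τ) := by ring
    rw [Real.norm_eq_abs, e3, abs_mul]
    refine (mul_le_of_le_one_left (abs_nonneg _) hcos).trans ?_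
    refine (abs_add_le _ _).trans ?_
    rw [add_comm]
    refine add_le_add ?_ (e2.trans ?_)
    · rw [abs_div, abs_of_pos hτ]
      gcongr
      rw [abs_le]
      constructor <;> linarith
    · gcongr
  · rw [integral_add, integral_div, integral_div, integral_const_mul, integral_sub,
      integral_exp_neg_mul_norm_sq (mul_pos hτ hKm), integral_exp_neg_mul_norm_sq (mul_pos hτ hKp0),
      integral_exp_neg_mul_norm_sq (half_pos (mul_pos hτ hKm))]
    · congr 4
      field_simp
    · exact hG _ (mul_pos hτ hKm)
    · exact hG _ (mul_pos hτ hKp0)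
    · exact ((hG _ (mul_pos hτ hKm)).sub (hG _ (mul_pos hτ hKp0))).div_const _
    · exact ((hG _ (half_pos (mul_pos hτ hKm))).const_mul _).div_const _

end Oscillatory

/-! ### Testing the transmission identities with conjugate waves. -/

section InteriorIdentity

variable {d : ℕ}

/-- Smooth cutoffs that equal `1` up to `h - 1 / τ` and vanish near `h`, with slope `O(τ)`. -/
lemma exists_cutoff : ∃ c : ℝ, 0 < c ∧ ∀ τ h : ℝ, 0 < τ → ∃ ψ : ℝ → ℝ, ContDiff ℝ ∞ ψ ∧
    Antitone ψ ∧ (∀ r, 0 ≤ ψ r) ∧ (∀ r, ψ r ≤ 1) ∧ (∀ r ≤ h - 1 / τ, ψ r = 1) ∧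
    (∃ ε > 0, ∀ r, h - ε ≤ r → ψ r = 0) ∧ ∀ r, |deriv ψ r| ≤ c * τ := by
  have hs : ContDiff ℝ ∞ Real.smoothTransition := Real.smoothTransition.contDiff (n := ⊤)
  have hsd : Differentiable ℝ Real.smoothTransition := hs.differentiable (by simp)
  have hcont : Continuous (deriv Real.smoothTransition) := hs.continuous_deriv (by simp)
  have hsupp : HasCompactSupport (deriv Real.smoothTransition) := by
    refine HasCompactSupport.intro (isCompact_Icc (a := (0 : ℝ)) (b := 1)) fun r hr => ?_
    rcases lt_or_ge r 0 with h | h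
    · have : Real.smoothTransition =ᶠ[𝓝 r] fun _ => 0 := by
        filter_upwards [Iio_mem_nhds h] with s hs
        exact Real.smoothTransition.zero_of_nonpos (le_of_lt hs)
      rw [this.deriv_eq, deriv_const]
    · have h1 : 1 < r := by
        by_contra h'
        exact hr ⟨h, not_lt.1 h'⟩
      have : Real.smoothTransition =ᶠ[𝓝 r] fun _ => 1 := by
        filter_upwards [Ioi_mem_nhds h1] with s hs
        exact Real.smoothTransition.one_of_one_le (le_of_lt hs)
      rw [this.deriv_eq, deriv_const]
  obtain ⟨C, hC⟩ := hsupp.exists_bound_of_continuous hcont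
  refine ⟨2 * (|C| + 1), by positivity, fun τ h hτ => ?_⟩
  have hl : ∀ r, HasDerivAt (fun r => 2 * τ * (h - r) - 1) (-(2 * τ)) r := fun r => by
    have := (((hasDerivAt_id r).const_sub h).const_mul (2 * τ)).sub_const 1
    simpa using this
  -- The argument is at least `1` for `r ≤ h - 1 / τ` and at most `0` for `r ≥ h - 1 / (2τ)`,
  -- leaving a strip of width `1 / (2τ)` in which `ψ` vanishes.
  refine ⟨fun r => Real.smoothTransition (2 * τ * (h - r) - 1), hs.comp (by fun_prop), ?_,
    fun r => Real.smoothTransition.nonneg _, fun r => Real.smoothTransition.le_one _, ?_,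
    ⟨1 / (2 * τ), by positivity, ?_⟩, ?_⟩
  · intro r s hrs
    apply Real.smoothTransition.monotone
    nlinarith
  · intro r hr
    apply Real.smoothTransition.one_of_one_le
    have : τ * (1 / τ) ≤ τ * (h - r) := mul_le_mul_of_nonneg_left (by linarith) hτ.le
    rw [mul_one_div_cancel hτ.ne'] at this
    linarith
  · intro r hr
    apply Real.smoothTransition.zero_of_nonpos
    have : 2 * τ * (h - r) ≤ 2 * τ * (1 / (2 * τ)) :=
      mul_le_mul_of_nonneg_left (by linarith) (by positivity)
    rw [mul_one_div_cancel (by positivity)] at this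
    linarith
  · intro r
    have := (hsd (2 * τ * (h - r) - 1)).hasDerivAt.comp r (hl r)
    rw [show (fun r => Real.smoothTransition (2 * τ * (h - r) - 1))
      = Real.smoothTransition ∘ fun r => 2 * τ * (h - r) - 1 from rfl, this.deriv, abs_mul,
      abs_neg, abs_of_pos (by positivity : 0 < 2 * τ)]
    have h2 : |deriv Real.smoothTransition (2 * τ * (h - r) - 1)| ≤ |C| + 1 :=
      ((hC _).trans (le_abs_self C)).trans (by linarith)
    nlinarith

/-- A vanishing mean gives `P x ∫ κ = ∫ κ(y) (P x - P y)`. This turns sup bounds at the lid into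
oscillation bounds. -/
lemma abs_le_of_weighted_mean_eq_zero {X : Type*} [MeasurableSpace X] {μ : Measure X}
    {S : Set X} (hS : MeasurableSet S) {κ P : X → ℝ} {ε : ℝ}
    (hκ : ∀ x ∈ S, 0 ≤ κ x) (hpos : 0 < ∫ x in S, κ x ∂μ)
    (hκi : IntegrableOn κ S μ) (hκP : IntegrableOn (fun x => κ x * P x) S μ)
    (hosc : ∀ x ∈ S, ∀ y ∈ S, |P x - P y| ≤ ε) (h0 : ∫ x in S, κ x * P x ∂μ = 0)
    {x : X} (hx : x ∈ S) : |P x| ≤ ε := by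
  have e1 : P x * ∫ y in S, κ y ∂μ = ∫ y in S, κ y * (P x - P y) ∂μ := by
    simp_rw [mul_sub]
    rw [integral_sub (hκi.mul_const _) hκP, h0, sub_zero, integral_mul_const, mul_comm]
  have e2 : |P x * ∫ y in S, κ y ∂μ| ≤ ∫ y in S, κ y * ε ∂μ := by
    rw [e1, ← Real.norm_eq_abs]
    refine norm_integral_le_of_norm_le (hκi.mul_const _) ?_
    filter_upwards [ae_restrict_mem hS] with y hy
    rw [norm_mul, Real.norm_eq_abs, Real.norm_eq_abs, abs_of_nonneg (hκ y hy)]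
    exact mul_le_mul_of_nonneg_left (hosc x hx y hy) (hκ y hy)
  rw [integral_mul_const, abs_mul, abs_of_pos hpos, mul_comm] at e2
  exact le_of_mul_le_mul_left e2 hpos

lemma integrableOn_continuous_mul {S : Set (EuclideanSpace ℝ (Fin (d + 1)))}
    (hSb : Bornology.IsBounded S) {m P : EuclideanSpace ℝ (Fin (d + 1)) → ℝ} (hm : Continuous m)
    (hSm : MeasurableSet S) (hP : IntegrableOn P S) : IntegrableOn (fun x => m x * P x) S := by
  obtain ⟨C, hC⟩ := hSb.isCompact_closure.exists_bound_of_continuousOn hm.continuousOn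
  refine Integrable.bdd_mul (c := C) hP hm.aestronglyMeasurable ?_
  filter_upwards [ae_restrict_mem hSm] with x hx using hC x (subset_closure hx)

/-- The real harmonic oscillation `exp (-τ xₙ) (p cos (τ v·x) + q sin (τ v·x))`. -/
noncomputable def decayWave (τ : ℝ) (v : EuclideanSpace ℝ (Fin (d + 1))) (p q : ℝ)
    (x : EuclideanSpace ℝ (Fin (d + 1))) : ℝ :=
  Real.exp (-τ * vert x) * (p * Real.cos (τ * inner ℝ v x) + q * Real.sin (τ * inner ℝ v x))

lemma contDiff_vert : ContDiff ℝ ∞ (vert (d := d)) := (vertL d).contDiff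

lemma contDiff_decayWave (τ : ℝ) (v : EuclideanSpace ℝ (Fin (d + 1))) (p q : ℝ) :
    ContDiff ℝ ∞ (decayWave τ v p q) := by
  have h1 := contDiff_vert (d := d)
  have h2 : ContDiff ℝ ∞ fun x => inner ℝ v x := (innerSL ℝ v).contDiff
  unfold decayWave
  fun_prop

lemma hasFDerivAt_vert (x : EuclideanSpace ℝ (Fin (d + 1))) :
    HasFDerivAt (vert (d := d)) (vertL d) x := (vertL d).hasFDerivAt

/-- The vertical derivative multiplies by `-τ`, and the derivative along `v` turns the coefficients
`(p, q)` into `(q, -p)`. This is the conjugacy that makes the gradient of one wave the rotated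
gradient of another. -/
lemma fderiv_decayWave (τ : ℝ) (v : EuclideanSpace ℝ (Fin (d + 1))) (p q : ℝ)
    (x y : EuclideanSpace ℝ (Fin (d + 1))) :
    fderiv ℝ (decayWave τ v p q) x y
      = -τ * vert y * decayWave τ v p q x + τ * inner ℝ v y * decayWave τ v q (-p) x := by
  have h1 : HasFDerivAt (fun x => Real.exp (-τ * vert x)) _ x :=
    ((hasFDerivAt_vert x).const_mul (-τ)).exp
  have h2 : HasFDerivAt (fun x => τ * inner ℝ v x) _ x :=
    ((innerSL ℝ v).hasFDerivAt (x := x)).const_mul τ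
  have h3 := (h2.cos.const_mul p).add (h2.sin.const_mul q)
  have h4 := h1.mul h3
  rw [show decayWave τ v p q = fun x => Real.exp (-τ * vert x) *
    (p * Real.cos (τ * inner ℝ v x) + q * Real.sin (τ * inner ℝ v x)) from rfl]
  refine (congrArg (fun L => L y) h4.fderiv).trans ?_
  simp [decayWave]
  ring

lemma abs_decayWave_le (τ : ℝ) (v : EuclideanSpace ℝ (Fin (d + 1))) (p q : ℝ)
    (x : EuclideanSpace ℝ (Fin (d + 1))) :
    |decayWave τ v p q x| ≤ (|p| + |q|) * Real.exp (-τ * vert x) := by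
  rw [decayWave, abs_mul, abs_of_pos (Real.exp_pos _), mul_comm]
  gcongr
  refine (abs_add_le _ _).trans (add_le_add ?_ ?_) <;> rw [abs_mul]
  · exact mul_le_of_le_one_right (abs_nonneg _) (Real.abs_cos_le_one _)
  · exact mul_le_of_le_one_right (abs_nonneg _) (Real.abs_sin_le_one _)

lemma fderiv_cutoff_mul {ψ : ℝ → ℝ} (hψ : ContDiff ℝ ∞ ψ)
    {F : EuclideanSpace ℝ (Fin (d + 1)) → ℝ} (hF : ContDiff ℝ ∞ F)
    (x y : EuclideanSpace ℝ (Fin (d + 1))) :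
    fderiv ℝ (fun x => ψ (vert x) * F x) x y
      = deriv ψ (vert x) * vert y * F x + ψ (vert x) * fderiv ℝ F x y := by
  have h1 : HasFDerivAt (fun x => ψ (vert x)) _ x :=
    ((hψ.differentiable (by simp) (vert x)).hasDerivAt).comp_hasFDerivAt x (hasFDerivAt_vert x)
  have h2 := (hF.differentiable (by simp) x).hasFDerivAt
  refine (congrArg (fun L => L y) (h1.mul h2).fderiv).trans ?_
  simp
  ring

lemma abs_vert_le_norm (z : EuclideanSpace ℝ (Fin (d + 1))) : |vert z| ≤ ‖z‖ :=
  abs_le_of_sq_le_sq (by nlinarith [norm_sq_eq_horiz_add_vert z, sq_nonneg ‖horiz z‖])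
    (norm_nonneg _)

lemma vert_eLast : vert (eLast d) = 1 := by simp [vert, eLast]

/-- A function whose mean against the weight `ψ'(xₙ)` vanishes is bounded by its oscillation. -/
lemma abs_le_of_integral_deriv_cutoff_mul_eq_zero {S : Set (EuclideanSpace ℝ (Fin (d + 1)))}
    {τ h ε : ℝ} {ψ : ℝ → ℝ} {P : EuclideanSpace ℝ (Fin (d + 1)) → ℝ}
    (hSo : IsOpen S) (hSb : Bornology.IsBounded S)
    (hSaxis : ∀ r, 0 < r → r < h → r • eLast d ∈ S) (hτ : 0 < τ) (hτh : 1 < τ * h)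
    (hψ : ContDiff ℝ ∞ ψ) (hanti : Antitone ψ)
    (hone : ∀ r ≤ h - 1 / τ, ψ r = 1) (hzero : ∃ ε > 0, ∀ r, h - ε ≤ r → ψ r = 0)
    (hP : IntegrableOn P S) (hosc : ∀ x ∈ S, ∀ y ∈ S, |P x - P y| ≤ ε)
    (h0 : ∫ x in S, deriv ψ (vert x) * P x = 0) {x : EuclideanSpace ℝ (Fin (d + 1))}
    (hx : x ∈ S) : |P x| ≤ ε := by
  have hSm := hSo.measurableSet
  have hSfin : volume S < ⊤ := hSb.measure_lt_top
  have hcv := continuous_vert (d := d)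
  have hψc := hψ.continuous
  have hψ'c : Continuous (deriv ψ) := hψ.continuous_deriv (by simp)
  have hven := vert_eLast (d := d)
  have one : IntegrableOn (fun _ : EuclideanSpace ℝ (Fin (d + 1)) => (1 : ℝ)) S :=
    integrableOn_const hSfin.ne
  have hκ0 : ∀ r, 0 ≤ -deriv ψ r := fun r => neg_nonneg.2 hanti.deriv_nonpos
  have hκi : IntegrableOn (fun x => -deriv ψ (vert x)) S := by
    simpa using (integrableOn_continuous_mul hSb (m := fun x => -deriv ψ (vert x)) (by fun_prop) hSm one)
  have hκpos : 0 < ∫ x in S, -deriv ψ (vert x) := by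
    -- Since `ψ` drops from `1` to `0` on `[h - 1/τ, h]`, the mean value theorem gives a height with
    -- `ψ' < 0`. It is positive because `τ h > 1`, so the axis point at that height lies in `S`, and
    -- openness gives positive mass.
    have hlt : h - 1 / τ < h := by have := one_div_pos.2 hτ; linarith
    obtain ⟨r, hr, hrd⟩ := exists_deriv_eq_slope ψ hlt hψc.continuousOn
      (hψ.differentiable (by simp)).differentiableOn
    have hh : ψ h = 0 := by
      obtain ⟨ε, hε, hz⟩ := hzero
      exact hz h (by linarith)
    have hr0 : 0 < r := by
      refine lt_trans ?_ hr.1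
      rw [sub_pos, div_lt_iff₀ hτ]
      linarith
    have hneg : 0 < -deriv ψ r := by
      rw [hrd, hone _ le_rfl, hh]
      simp only [zero_sub, sub_sub_cancel]
      rw [neg_div, neg_neg]
      positivity
    rw [setIntegral_pos_iff_support_of_nonneg_ae
      (Eventually.of_forall fun x => hκ0 _) hκi]
    have hopen : IsOpen ({x : EuclideanSpace ℝ (Fin (d + 1)) | 0 < -deriv ψ (vert x)} ∩ S) :=
      (isOpen_lt continuous_const (by fun_prop)).inter hSo
    refine lt_of_lt_of_le (hopen.measure_pos volume ⟨r • eLast d, ?_, hSaxis r hr0 hr.2⟩)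
      (measure_mono (inter_subset_inter_left _ fun x hx => (ne_of_gt hx)))
    have : vert (r • eLast d) = r := by
      rw [← vertL_apply, map_smul, vertL_apply, hven, smul_eq_mul, mul_one]
    simpa [this] using hneg
  refine abs_le_of_weighted_mean_eq_zero hSm (κ := fun x => -deriv ψ (vert x)) (fun x _ => hκ0 _)
    hκpos hκi (integrableOn_continuous_mul hSb (by fun_prop) hSm hP) hosc ?_ hx
  simp only [neg_mul, integral_neg, h0, neg_zero]

/-- The bulk part uses only `exp (-τ s) ≤ 1`. The lid part is present only for `s ≥ h - 1 / τ`,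
where the waves are of size `exp (1 - τ h)`. -/
lemma abs_remainder_le {η τ h c δ₁ δ₂ δ₃ s ψs ψ' f Q N u₁ u₂ p₁ p₂ : ℝ} (hτ : 0 < τ) (hN : 0 ≤ N)
    (hc : 0 ≤ c) (hδ₂ : 0 ≤ δ₂) (hδ₃ : 0 ≤ δ₃) (hs : 0 ≤ s)
    (hψ0 : 0 ≤ ψs) (hψ1 : ψs ≤ 1) (hψ' : |ψ'| ≤ c * τ) (hlow : s < h - 1 / τ → ψ' = 0)
    (hf : |f| ≤ 2 * N * Real.exp (-τ * s)) (hQ : |Q| ≤ 2 * N * Real.exp (-τ * s))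
    (hu₁ : |u₁| ≤ δ₁) (hu₂ : |u₂| ≤ δ₁) (hp₁ : |p₁| ≤ |η| * δ₂ + δ₃) (hp₂ : |p₂| ≤ δ₂ + δ₃) :
    |(η - 1) * (ψs * (-τ * f * u₁ + τ * Q * u₂)) - ψ' * (f * p₁ + Q * p₂)|
      ≤ |η - 1| * (4 * τ * N * δ₁)
        + 2 * c * τ * N * Real.exp (1 - τ * h) * ((|η| + 1) * δ₂ + 2 * δ₃) := by
  have hE : Real.exp (-τ * s) ≤ 1 := Real.exp_le_one_iff.2 (by nlinarith)
  have hf1 : |f| ≤ 2 * N := hf.trans (mul_le_of_le_one_right (by positivity) hE)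
  have hQ1 : |Q| ≤ 2 * N := hQ.trans (mul_le_of_le_one_right (by positivity) hE)
  refine (abs_sub _ _).trans (add_le_add ?_ ?_)
  · rw [abs_mul, abs_mul, abs_of_nonneg hψ0]
    refine mul_le_mul_of_nonneg_left ?_ (abs_nonneg _)
    refine (mul_le_of_le_one_left (abs_nonneg _) hψ1).trans ((abs_add_le _ _).trans ?_)
    simp only [abs_mul, abs_neg, abs_of_pos hτ]
    calc τ * |f| * |u₁| + τ * |Q| * |u₂| ≤ τ * (2 * N) * δ₁ + τ * (2 * N) * δ₁ := by gcongr
      _ = 4 * τ * N * δ₁ := by ring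
  · by_cases hl : s < h - 1 / τ
    · rw [hlow hl, zero_mul, abs_zero]
      positivity
    · have hE2 : Real.exp (-τ * s) ≤ Real.exp (1 - τ * h) := by
        apply Real.exp_le_exp.2
        have := mul_le_mul_of_nonneg_left (not_lt.1 hl) hτ.le
        have h2 : τ * (h - 1 / τ) = τ * h - 1 := by field_simp
        linarith
      have hf2 : |f| ≤ 2 * N * Real.exp (1 - τ * h) := hf.trans (by gcongr)
      have hQ2 : |Q| ≤ 2 * N * Real.exp (1 - τ * h) := hQ.trans (by gcongr)
      rw [abs_mul]
      calc |ψ'| * |f * p₁ + Q * p₂|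
          ≤ (c * τ) * (2 * N * Real.exp (1 - τ * h) * (|η| * δ₂ + δ₃)
            + 2 * N * Real.exp (1 - τ * h) * (δ₂ + δ₃)) := by
            gcongr
            refine (abs_add_le _ _).trans ?_
            rw [abs_mul, abs_mul]
            gcongr
        _ = _ := by ring

/-- The basic estimate for the main oscillatory integral, obtained by testing the two transmission
identities with cut-off harmonic oscillations. -/
lemma abs_main_integral_le {S : Set (EuclideanSpace ℝ (Fin (d + 1)))} {η τ h c δ₁ δ₂ δ₃ : ℝ}
    {a e : EuclideanSpace ℝ (Fin (d + 1)) → EuclideanSpace ℝ (Fin (d + 1))}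
    {g v : EuclideanSpace ℝ (Fin (d + 1))} {q : ℝ} {ψ : ℝ → ℝ}
    (hSo : IsOpen S) (hSb : Bornology.IsBounded S) (hS0 : ∀ x ∈ S, 0 ≤ vert x)
    (hSaxis : ∀ r, 0 < r → r < h → r • eLast d ∈ S)
    (hτ : 0 < τ) (hτh : 1 < τ * h)
    (hψ : ContDiff ℝ ∞ ψ) (hanti : Antitone ψ) (hψ0 : ∀ r, 0 ≤ ψ r) (hψ1 : ∀ r, ψ r ≤ 1)
    (hone : ∀ r ≤ h - 1 / τ, ψ r = 1) (hzero : ∃ ε > 0, ∀ r, h - ε ≤ r → ψ r = 0)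
    (hder : ∀ r, |deriv ψ r| ≤ c * τ)
    (hv : ‖v‖ = 1) (hv0 : vert v = 0) (hg : g = q • v + vert g • eLast d)
    (ha : IntegrableOn a S) (he : IntegrableOn e S)
    (hag : ∀ x ∈ S, ‖a x - g‖ ≤ δ₁) (haa : ∀ x ∈ S, ∀ y ∈ S, ‖a x - a y‖ ≤ δ₂)
    (hee : ∀ x ∈ S, ∀ y ∈ S, ‖e x - e y‖ ≤ δ₃)
    (H1 : ∀ φ : EuclideanSpace ℝ (Fin (d + 1)) → ℝ, ContDiff ℝ ∞ φ →
      (∃ ε > 0, ∀ x, h - ε ≤ vert x → φ x = 0) →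
      ∫ x in S, inner ℝ (η • a x - e x) (gradient φ x) = 0)
    (H2 : ∀ φ : EuclideanSpace ℝ (Fin (d + 1)) → ℝ, ContDiff ℝ ∞ φ →
      (∃ ε > 0, ∀ x, h - ε ≤ vert x → φ x = 0) →
      ∫ x in S, inner ℝ (a x - e x) (fderiv ℝ φ x v • eLast d - fderiv ℝ φ x (eLast d) • v) = 0) :
    |η - 1| * (τ * ‖g‖ ^ 2 *
        |∫ x in S, ψ (vert x) * Real.exp (-τ * vert x) * Real.cos (τ * inner ℝ v x)|)
      ≤ (|η - 1| * (4 * τ * ‖g‖ * δ₁)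
        + 2 * c * τ * ‖g‖ * Real.exp (1 - τ * h) * ((|η| + 1) * δ₂ + 2 * δ₃)) * volume.real S := by
  have hSm := hSo.measurableSet
  have hSfin : volume S < ⊤ := hSb.measure_lt_top
  have hcv := continuous_vert (d := d)
  have hψc := hψ.continuous
  have hψ'c : Continuous (deriv ψ) := hψ.continuous_deriv (by simp)
  have hven := vert_eLast (d := d)
  have hvv : inner ℝ v v = 1 := by rw [real_inner_self_eq_norm_sq, hv, one_pow]
  have hve : inner ℝ v (eLast d) = 0 := by rw [inner_eLast, hv0]
  have hnorm : ‖g‖ ^ 2 = q ^ 2 + vert g ^ 2 := by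
    conv_lhs => rw [hg]
    rw [← real_inner_self_eq_norm_sq]
    have hee1 : inner ℝ (eLast d) (eLast d) = 1 := by
      rw [real_inner_self_eq_norm_sq, norm_eLast, one_pow]
    simp only [inner_add_left, inner_add_right, inner_smul_left, inner_smul_right, hvv, hve,
      hee1, real_inner_comm]
    have : inner ℝ (eLast d) v = 0 := by rw [real_inner_comm, hve]
    simp
    ring
  have hgq : |q| ≤ ‖g‖ := abs_le_of_sq_le_sq (by nlinarith [sq_nonneg (vert g)]) (norm_nonneg _)
  have hgn : |vert g| ≤ ‖g‖ := abs_le_of_sq_le_sq (by nlinarith [sq_nonneg q]) (norm_nonneg _)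
  have hinabs : ∀ z : EuclideanSpace ℝ (Fin (d + 1)), |inner ℝ v z| ≤ ‖z‖ := fun z => by
    simpa [hv] using abs_real_inner_le_norm v z
  have hVi : IntegrableOn (fun x => η • a x - e x) S := (ha.smul η).sub he
  have hWi : IntegrableOn (fun x => a x - e x) S := ha.sub he
  have hVn : IntegrableOn (fun x => vert (η • a x - e x)) S := (vertL d).integrable_comp hVi
  have hVv : IntegrableOn (fun x => inner ℝ v (η • a x - e x)) S := hVi.const_inner v
  have hWn : IntegrableOn (fun x => vert (a x - e x)) S := (vertL d).integrable_comp hWi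
  have hWv : IntegrableOn (fun x => inner ℝ v (a x - e x)) S := hWi.const_inner v
  have mul : ∀ {m P : EuclideanSpace ℝ (Fin (d + 1)) → ℝ}, Continuous m → IntegrableOn P S →
      IntegrableOn (fun x => m x * P x) S := fun hm hP => integrableOn_continuous_mul hSb hm hSm hP
  have one : IntegrableOn (fun _ : EuclideanSpace ℝ (Fin (d + 1)) => (1 : ℝ)) S :=
    integrableOn_const hSfin.ne
  have vanish : ∀ F : EuclideanSpace ℝ (Fin (d + 1)) → ℝ,
      ∃ ε > 0, ∀ x, h - ε ≤ vert x → ψ (vert x) * F x = 0 := fun F => by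
    obtain ⟨ε, hε, hz⟩ := hzero
    exact ⟨ε, hε, fun x hx => by rw [hz _ hx, zero_mul]⟩
  have smooth : ∀ F : EuclideanSpace ℝ (Fin (d + 1)) → ℝ, ContDiff ℝ ∞ F →
      ContDiff ℝ ∞ fun x => ψ (vert x) * F x := fun F hF => (hψ.comp contDiff_vert).mul hF
  have f1 : ∀ x y, fderiv ℝ (fun x : EuclideanSpace ℝ (Fin (d + 1)) => ψ (vert x) * 1) x y
      = deriv ψ (vert x) * vert y := fun x y => by
    rw [fderiv_cutoff_mul hψ contDiff_const]
    simp
  -- The test function `ψ(xₙ)` has gradient `ψ'(xₙ) eₙ`, so the flux law says that this component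
  -- has mean zero for the weight `ψ'`.
  have P1 : ∀ x ∈ S, |vert (η • a x - e x)| ≤ |η| * δ₂ + δ₃ := by
    intro x hx
    refine abs_le_of_integral_deriv_cutoff_mul_eq_zero (P := fun x => vert (η • a x - e x))
      hSo hSb hSaxis hτ hτh hψ hanti hone hzero hVn ?_ ?_ hx
    · intro x hx y hy
      have : vert (η • a x - e x) - vert (η • a y - e y)
          = vert (η • (a x - a y) - (e x - e y)) := by
        simp only [← vertL_apply, ← map_sub]
        congr 1
        module
      rw [this]
      refine (abs_vert_le_norm _).trans ((norm_sub_le _ _).trans ?_)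
      rw [norm_smul, Real.norm_eq_abs]
      have := haa x hx y hy
      have := hee x hx y hy
      gcongr
    · have := H1 _ (smooth (fun _ => 1) contDiff_const) (vanish fun _ => 1)
      simp only [inner_gradient_right, f1, conj_trivial] at this
      exact this
  -- The same test function in the tangential law leaves `-ψ'(xₙ) v`, because `v` is horizontal.
  have P2 : ∀ x ∈ S, |inner ℝ v (a x - e x)| ≤ δ₂ + δ₃ := by
    intro x hx
    refine abs_le_of_integral_deriv_cutoff_mul_eq_zero (P := fun x => inner ℝ v (a x - e x))
      hSo hSb hSaxis hτ hτh hψ hanti hone hzero hWv ?_ ?_ hx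
    · intro x hx y hy
      rw [← inner_sub_right]
      have : a x - e x - (a y - e y) = (a x - a y) - (e x - e y) := by abel
      rw [this]
      refine (hinabs _).trans ((norm_sub_le _ _).trans ?_)
      exact add_le_add (haa x hx y hy) (hee x hx y hy)
    · have := H2 _ (smooth (fun _ => 1) contDiff_const) (vanish fun _ => 1)
      simp only [f1] at this
      simp only [hv0, hven, mul_zero, mul_one, zero_smul, zero_sub, inner_neg_right,
        inner_smul_right] at this
      rw [integral_neg, neg_eq_zero] at this
      simpa only [real_inner_comm] using this
  -- Coefficients chosen so that `g · ∇f = τ (q Q - gₙ f)` equals `τ |g|² exp (-τ xₙ) cos (τ v·x)`: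
  -- the sine terms cancel.
  set f := decayWave τ v (-vert g) q with hf
  set Q := decayWave τ v q (vert g) with hQ
  have hfs : ContDiff ℝ ∞ f := contDiff_decayWave _ _ _ _
  have hQs : ContDiff ℝ ∞ Q := contDiff_decayWave _ _ _ _
  have hfc := hfs.continuous
  have hQc := hQs.continuous
  have df : ∀ x y, fderiv ℝ f x y = -τ * vert y * f x + τ * inner ℝ v y * Q x := fun x y => by
    rw [hf, fderiv_decayWave, neg_neg]
  have dQ : ∀ x y, fderiv ℝ Q x y = -τ * vert y * Q x - τ * inner ℝ v y * f x := fun x y => by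
    rw [hQ, fderiv_decayWave, hf]
    simp only [decayWave]
    ring
  have K1 := H1 _ (smooth f hfs) (vanish f)
  have K2 := H2 _ (smooth Q hQs) (vanish Q)
  simp only [inner_gradient_right, conj_trivial, fderiv_cutoff_mul hψ hfs, df] at K1
  simp only [inner_sub_right, inner_smul_right, fderiv_cutoff_mul hψ hQs, dQ, hv0, hven, hve,
    hvv, inner_eLast] at K2
  have I1 : IntegrableOn (fun x => deriv ψ (vert x) * vert (η • a x - e x) * f x + ψ (vert x) *
      (-τ * vert (η • a x - e x) * f x + τ * inner ℝ v (η • a x - e x) * Q x)) S := by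
    have i1 := mul (m := fun x => deriv ψ (vert x) * f x - τ * ψ (vert x) * f x)
      (by fun_prop) hVn
    have i2 := mul (m := fun x => τ * ψ (vert x) * Q x) (by fun_prop) hVv
    refine (i1.add i2).congr (Eventually.of_forall fun x => ?_)
    simp only [Pi.add_apply]
    ring
  have I2 : IntegrableOn (fun x => (deriv ψ (vert x) * 0 * Q x + ψ (vert x) *
      (-τ * 0 * Q x - τ * 1 * f x)) * vert (a x - e x) - (deriv ψ (vert x) * 1 * Q x + ψ (vert x) *
      (-τ * 1 * Q x - τ * 0 * f x)) * inner ℝ (a x - e x) v) S := by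
    have i1 := mul (m := fun x => deriv ψ (vert x) * 0 * Q x + ψ (vert x) *
      (-τ * 0 * Q x - τ * 1 * f x)) (by fun_prop) hWn
    have i2 := mul (m := fun x => deriv ψ (vert x) * 1 * Q x + ψ (vert x) *
      (-τ * 1 * Q x - τ * 0 * f x)) (by fun_prop) hWv
    refine (i1.sub i2).congr (Eventually.of_forall fun x => ?_)
    simp only [Pi.sub_apply, real_inner_comm]
  have I0 : IntegrableOn (fun x => ψ (vert x) * Real.exp (-τ * vert x) *
      Real.cos (τ * inner ℝ v x)) S := by
    simpa using mul (m := fun x => ψ (vert x) * Real.exp (-τ * vert x) *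
      Real.cos (τ * inner ℝ v x)) (by fun_prop) one
  -- Since `∇f = ∂_v Q eₙ - ∂ₙQ v`, the integrand of `K1` minus that of `K2` is `(η - 1) ψ a · ∇f`
  -- plus the `ψ'` terms. `R` is what remains after `a` is replaced by `g` and the two vanishing
  -- integrals are removed.
  let R : EuclideanSpace ℝ (Fin (d + 1)) → ℝ := fun x =>
    (η - 1) * (ψ (vert x) * (-τ * f x * vert (g - a x) + τ * Q x * inner ℝ v (g - a x)))
      - deriv ψ (vert x) * (f x * vert (η • a x - e x) + Q x * inner ℝ v (a x - e x))
  have hR : (η - 1) * (τ * ‖g‖ ^ 2 *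
      ∫ x in S, ψ (vert x) * Real.exp (-τ * vert x) * Real.cos (τ * inner ℝ v x))
      = ∫ x in S, R x := by
    have gen : ∀ {F₀ F₁ F₂ : EuclideanSpace ℝ (Fin (d + 1)) → ℝ}, IntegrableOn F₀ S →
        IntegrableOn F₁ S → IntegrableOn F₂ S → ∫ x in S, F₁ x = 0 → ∫ x in S, F₂ x = 0 →
        (∀ x, F₀ x - F₁ x + F₂ x = R x) → ∫ x in S, F₀ x = ∫ x in S, R x := by
      intro F₀ F₁ F₂ h0 h1 h2 e1 e2 hx
      have h01 : IntegrableOn (fun x => F₀ x - F₁ x) S := h0.sub h1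
      rw [← integral_congr_ae (Eventually.of_forall hx), integral_add h01 h2,
        integral_sub h0 h1, e1, e2]
      ring
    rw [← integral_const_mul, ← integral_const_mul]
    refine gen ((I0.const_mul _).const_mul _) I1 I2 K1 K2 fun x => ?_
    have hgv : inner ℝ v g = q := by
      rw [hg, inner_add_right, inner_smul_right, inner_smul_right, hvv, hve]
      ring
    have vsub : ∀ y z, vert (d := d) (y - z) = vert y - vert z := fun y z => rfl
    have vsmul : ∀ (r : ℝ) y, vert (d := d) (r • y) = r * vert y := fun r y => rfl
    simp only [R, vsub, vsmul, inner_sub_right, inner_smul_right,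
      hgv, hnorm, real_inner_comm v]
    simp only [hf, hQ, decayWave]
    ring
  have bd : ∀ x ∈ S, ‖R x‖ ≤ |η - 1| * (4 * τ * ‖g‖ * δ₁)
      + 2 * c * τ * ‖g‖ * Real.exp (1 - τ * h) * ((|η| + 1) * δ₂ + 2 * δ₃) := by
    intro x hx
    have hδ₂ : 0 ≤ δ₂ := (norm_nonneg _).trans (haa x hx x hx)
    have hδ₃ : 0 ≤ δ₃ := (norm_nonneg _).trans (hee x hx x hx)
    have hc : 0 ≤ c := by
      have := (abs_nonneg _).trans (hder 0)
      exact nonneg_of_mul_nonneg_left this hτ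
    have ga : ‖g - a x‖ ≤ δ₁ := by rw [norm_sub_rev]; exact hag x hx
    refine abs_remainder_le hτ (norm_nonneg g) hc hδ₂ hδ₃ (hS0 x hx) (hψ0 _) (hψ1 _) (hder _)
      (fun hlow => ?_) ?_ ?_ ((abs_vert_le_norm _).trans ga) ((hinabs _).trans ga) (P1 x hx)
      (P2 x hx)
    · have : ψ =ᶠ[𝓝 (vert x)] fun _ => 1 := by
        filter_upwards [Iio_mem_nhds hlow] with s hs using hone s (le_of_lt hs)
      rw [this.deriv_eq, deriv_const]
    · refine (abs_decayWave_le _ _ _ _ _).trans ?_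
      rw [abs_neg]
      gcongr
      linarith
    · refine (abs_decayWave_le _ _ _ _ _).trans ?_
      gcongr
      linarith
  have := norm_setIntegral_le_of_norm_le_const hSfin bd
  rw [← hR, Real.norm_eq_abs, abs_mul, abs_mul, abs_of_nonneg (by positivity : 0 ≤ τ * ‖g‖ ^ 2)]
    at this
  exact this

end InteriorIdentity

/-! ### Transfer of the identities through the rigid motion. -/

section Transfer

variable {d : ℕ}

lemma exists_test_cutoff {K O : Set (EuclideanSpace ℝ (Fin (d + 1)))} (hK : IsCompact K)
    (hO : IsOpen O) (hKO : K ⊆ O) : ∃ χ : EuclideanSpace ℝ (Fin (d + 1)) → ℝ,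
      ContDiff ℝ ∞ χ ∧ HasCompactSupport χ ∧ tsupport χ ⊆ O ∧ ∀ x ∈ K, χ x = 1 := by
  obtain ⟨T, hT, hKT, hTO⟩ := exists_compact_between hK hO hKO
  obtain ⟨f, hf1, hf0, -⟩ := exists_contMDiffMap_one_nhds_of_subset_interior
    (n := ⊤) (modelWithCornersSelf ℝ (EuclideanSpace ℝ (Fin (d + 1)))) hK.isClosed hKT
  have hsupp : tsupport f ⊆ T := closure_minimal (fun x hx => by
    by_contra h
    exact hx (hf0 x h)) hT.isClosed
  exact ⟨f, f.contMDiff.contDiff, hT.of_isClosed_subset (isClosed_tsupport _) hsupp,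
    hsupp.trans hTO, fun x hx => hf1.self_of_nhdsSet x hx⟩

lemma AffineIsometryEquiv.measurePreserving_euclidean
    (Φ : EuclideanSpace ℝ (Fin (d + 1)) ≃ᵃⁱ[ℝ] EuclideanSpace ℝ (Fin (d + 1))) :
    MeasurePreserving Φ := by
  have h : (Φ : EuclideanSpace ℝ (Fin (d + 1)) → EuclideanSpace ℝ (Fin (d + 1)))
      = (fun y => y + Φ 0) ∘ Φ.linearIsometryEquiv := by
    ext1 x
    have := Φ.map_vadd 0 x
    simpa using this
  rw [h]
  exact (measurePreserving_add_right volume (Φ 0)).comp Φ.linearIsometryEquiv.measurePreserving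

lemma AffineIsometryEquiv.hasFDerivAt_euclidean
    (Φ : EuclideanSpace ℝ (Fin (d + 1)) ≃ᵃⁱ[ℝ] EuclideanSpace ℝ (Fin (d + 1)))
    (x : EuclideanSpace ℝ (Fin (d + 1))) :
    HasFDerivAt Φ (Φ.linearIsometryEquiv.toContinuousLinearEquiv :
      EuclideanSpace ℝ (Fin (d + 1)) →L[ℝ] EuclideanSpace ℝ (Fin (d + 1))) x := by
  have h : (Φ : EuclideanSpace ℝ (Fin (d + 1)) → EuclideanSpace ℝ (Fin (d + 1)))
      = fun y => Φ.linearIsometryEquiv y + Φ 0 := by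
    ext1 x
    have := Φ.map_vadd 0 x
    simpa using this
  rw [h]
  exact Φ.linearIsometryEquiv.toContinuousLinearEquiv.hasFDerivAt.add_const _

lemma AffineIsometryEquiv.contDiff_euclidean
    (Φ : EuclideanSpace ℝ (Fin (d + 1)) ≃ᵃⁱ[ℝ] EuclideanSpace ℝ (Fin (d + 1))) :
    ContDiff ℝ ∞ Φ := by
  have h : (Φ : EuclideanSpace ℝ (Fin (d + 1)) → EuclideanSpace ℝ (Fin (d + 1)))
      = fun y => Φ.linearIsometryEquiv y + Φ 0 := by
    ext1 x
    have := Φ.map_vadd 0 x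
    simpa using this
  rw [h]
  exact Φ.linearIsometryEquiv.contDiff.add contDiff_const

lemma AffineIsometryEquiv.setIntegral_image
    (Φ : EuclideanSpace ℝ (Fin (d + 1)) ≃ᵃⁱ[ℝ] EuclideanSpace ℝ (Fin (d + 1)))
    (T : Set (EuclideanSpace ℝ (Fin (d + 1)))) (F : EuclideanSpace ℝ (Fin (d + 1)) → ℝ) :
    ∫ y in Φ '' T, F y = ∫ x in T, F (Φ x) := by
  rw [← Φ.measurePreserving_euclidean.setIntegral_preimage_emb
    Φ.toHomeomorph.measurableEmbedding, preimage_image_eq _ Φ.injective]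

/-- The transmission identities in rotated coordinates, for test functions that need only vanish
near the lid of the cylinder. -/
lemma transmission_image {D U : Set (EuclideanSpace ℝ (Fin (d + 1)))} {η h : ℝ}
    {a e : EuclideanSpace ℝ (Fin (d + 1)) → EuclideanSpace ℝ (Fin (d + 1))}
    (hD : IsOpen D) (hU : IsOpen U)
    (Φ : EuclideanSpace ℝ (Fin (d + 1)) ≃ᵃⁱ[ℝ] EuclideanSpace ℝ (Fin (d + 1)))
    (htr : ∀ φ : EuclideanSpace ℝ (Fin (d + 1)) → ℝ, ContDiff ℝ ∞ φ → HasCompactSupport φ →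
      tsupport φ ⊆ U →
      (∫ x in U ∩ D, inner ℝ (η • a x - e x) (gradient φ x) = 0) ∧
      ∀ v z, ∫ x in U ∩ D, inner ℝ (a x - e x) (fderiv ℝ φ x v • z - fderiv ℝ φ x z • v) = 0)
    (hcomp : ∀ ε > 0, ∃ T, IsCompact T ∧ T ⊆ Φ '' U ∧
      ∀ y ∈ Φ '' (U ∩ D), vert y ≤ h - ε → y ∈ T)
    {φ : EuclideanSpace ℝ (Fin (d + 1)) → ℝ} (hφ : ContDiff ℝ ∞ φ)
    (hφ0 : ∃ ε > 0, ∀ x, h - ε ≤ vert x → φ x = 0) :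
    (∫ y in Φ '' (U ∩ D), inner ℝ (η • Φ.linearIsometryEquiv (a (Φ.symm y))
      - Φ.linearIsometryEquiv (e (Φ.symm y))) (gradient φ y) = 0) ∧
    ∀ v z, ∫ y in Φ '' (U ∩ D), inner ℝ (Φ.linearIsometryEquiv (a (Φ.symm y))
      - Φ.linearIsometryEquiv (e (Φ.symm y))) (fderiv ℝ φ y v • z - fderiv ℝ φ y z • v) = 0 := by
  obtain ⟨ε, hε, hφ0⟩ := hφ0
  obtain ⟨T, hT, hTU, hTm⟩ := hcomp (ε / 2) (by positivity)
  obtain ⟨χ, hχ, hχc, hχU, hχ1⟩ := exists_test_cutoff hT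
    (Φ.toHomeomorph.isOpenMap U hU) hTU
  set R := Φ.linearIsometryEquiv with hR
  -- `k` is an admissible test function and has the same derivative as `φ` on the region: `χ = 1`
  -- there below `h - ε / 2`, while `φ` vanishes locally above `h - ε`.
  let k : EuclideanSpace ℝ (Fin (d + 1)) → ℝ := fun y => χ y * φ y
  have hk : ContDiff ℝ ∞ k := hχ.mul hφ
  have hkc : HasCompactSupport k := hχc.mul_right
  have hkU : tsupport k ⊆ Φ '' U := (tsupport_mul_subset_left).trans hχU
  have hkΦc : HasCompactSupport (k ∘ Φ) := hkc.comp_homeomorph Φ.toHomeomorph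
  have hkΦU : tsupport (k ∘ Φ) ⊆ U := by
    have := tsupport_comp_eq_preimage k Φ.toHomeomorph
    intro x hx
    have hx' : Φ x ∈ tsupport k := by
      have h2 : x ∈ tsupport (k ∘ Φ.toHomeomorph) := hx
      rw [this] at h2
      exact h2
    obtain ⟨x', hx', hxx⟩ := hkU hx'
    rwa [← Φ.injective hxx]
  have hfd : ∀ y ∈ Φ '' (U ∩ D), fderiv ℝ k y = fderiv ℝ φ y := by
    intro y hy
    apply Filter.EventuallyEq.fderiv_eq
    have ho : IsOpen (Φ '' (U ∩ D)) := Φ.toHomeomorph.isOpenMap _ (hU.inter hD)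
    rcases lt_or_ge (vert y) (h - ε / 2) with hv | hv
    · filter_upwards [ho.mem_nhds hy, (isOpen_lt continuous_vert continuous_const).mem_nhds hv]
        with x hx1 hx2
      simp only [k, hχ1 x (hTm x hx1 (le_of_lt hx2)), one_mul]
    · have hv' : h - ε < vert y := by linarith
      filter_upwards [(isOpen_lt continuous_const continuous_vert).mem_nhds hv'] with x hx
      simp only [k, hφ0 x (le_of_lt hx), mul_zero]
  have hcomp' : ∀ x z, fderiv ℝ (k ∘ Φ) x z = fderiv ℝ k (Φ x) (R z) := fun x z => by
    rw [((hk.differentiable (by simp) (Φ x)).hasFDerivAt.comp x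
      (Φ.hasFDerivAt_euclidean x)).fderiv]
    rfl
  obtain ⟨h1, h2⟩ := htr (k ∘ Φ) (hk.comp Φ.contDiff_euclidean) hkΦc hkΦU
  have hm : MeasurableSet (U ∩ D) := (hU.inter hD).measurableSet
  constructor
  · rw [Φ.setIntegral_image, ← h1]
    refine setIntegral_congr_fun hm fun x hx => ?_
    simp only [Φ.symm_apply_apply, inner_gradient_right, conj_trivial, hcomp',
      hfd _ (mem_image_of_mem Φ hx), map_sub, map_smul]
  · intro v z
    -- The directions are rotated back, so that the curl field of `k ∘ Φ` is the inverse rotation of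
    -- that of `k`.
    rw [Φ.setIntegral_image, ← h2 (R.symm v) (R.symm z)]
    refine setIntegral_congr_fun hm fun x hx => ?_
    simp only [Φ.symm_apply_apply, hcomp', LinearIsometryEquiv.apply_symm_apply,
      hfd _ (mem_image_of_mem Φ hx)]
    conv_rhs => rw [← R.inner_map_map]
    simp only [LinearIsometryEquiv.apply_symm_apply, map_sub, map_smul]

end Transfer

/-! ### Geometry of the tip. -/

section Geometry

variable {d : ℕ} {D : Set (EuclideanSpace ℝ (Fin (d + 1)))} {p : EuclideanSpace ℝ (Fin (d + 1))}
  {K L M δ Kminus Kplus : ℝ} {w : EuclideanSpace ℝ (Fin d) → ℝ}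
  {Φ : EuclideanSpace ℝ (Fin (d + 1)) ≃ᵃⁱ[ℝ] EuclideanSpace ℝ (Fin (d + 1))}

/-- The graph function extended by the osculating paraboloid. -/
noncomputable def extendGraph (w : EuclideanSpace ℝ (Fin d) → ℝ) (b K : ℝ)
    (y : EuclideanSpace ℝ (Fin d)) : ℝ :=
  open Classical in (Metric.ball (0 : EuclideanSpace ℝ (Fin d)) b).piecewise w
    (fun y => K * ‖y‖ ^ 2) y

lemma extendGraph_of_lt {b : ℝ} {y : EuclideanSpace ℝ (Fin d)} (hy : ‖y‖ < b) :
    extendGraph w b K y = w y := by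
  classical
  exact piecewise_eq_of_mem _ _ _ (by simpa using hy)

lemma extendGraph_of_le {b : ℝ} {y : EuclideanSpace ℝ (Fin d)} (hy : b ≤ ‖y‖) :
    extendGraph w b K y = K * ‖y‖ ^ 2 := by
  classical
  exact piecewise_eq_of_notMem _ _ _ (by simpa using hy)

namespace IsAdmissibleKCurvaturePoint

lemma measurable_extendGraph
    (hp : IsAdmissibleKCurvaturePoint D p K L M δ Kminus Kplus w Φ) :
    Measurable (extendGraph w (√M / K) K) := by
  classical
  exact ContinuousOn.measurable_piecewise hp.contDiffOn.continuousOn (by fun_prop)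
    Metric.isOpen_ball.measurableSet

lemma le_extendGraph
    (hp : IsAdmissibleKCurvaturePoint D p K L M δ Kminus Kplus w Φ) (y : EuclideanSpace ℝ (Fin d)) :
    Kminus * ‖y‖ ^ 2 ≤ extendGraph w (√M / K) K y := by
  rcases lt_or_ge ‖y‖ (√M / K) with h | h
  · rw [extendGraph_of_lt h]
    exact (hp.bounds y (by simpa using h)).1
  · rw [extendGraph_of_le h]
    exact mul_le_mul_of_nonneg_right hp.Kminus_le (sq_nonneg _)

lemma extendGraph_le
    (hp : IsAdmissibleKCurvaturePoint D p K L M δ Kminus Kplus w Φ) (y : EuclideanSpace ℝ (Fin d)) :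
    extendGraph w (√M / K) K y ≤ Kplus * ‖y‖ ^ 2 := by
  rcases lt_or_ge ‖y‖ (√M / K) with h | h
  · rw [extendGraph_of_lt h]
    exact (hp.bounds y (by simpa using h)).2
  · rw [extendGraph_of_le h]
    exact mul_le_mul_of_nonneg_right hp.le_Kplus (sq_nonneg _)

lemma sq_radius
    (hp : IsAdmissibleKCurvaturePoint D p K L M δ Kminus Kplus w Φ) : (√M / K) ^ 2 = M / K ^ 2 := by
  rw [div_pow, Real.sq_sqrt (zero_le_one.trans hp.one_le_M)]

/-- At horizontal distance `b` or more the paraboloid has height at least `K b² = M / K ≥ h`, so the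
extension adds nothing below the lid. The tip is thus a region under one global graph with global
quadratic bounds. -/
lemma image_inter
    (hp : IsAdmissibleKCurvaturePoint D p K L M δ Kminus Kplus w Φ) :
    Φ '' (Φ ⁻¹' tipCylinder d (√M / K) (1 / K) ∩ D)
    = {x | extendGraph w (√M / K) K (horiz x) < vert x ∧ vert x < 1 / K} := by
  have hK := hp.K_pos
  have e1 : Φ '' (Φ ⁻¹' tipCylinder d (√M / K) (1 / K) ∩ D)
      = (Φ '' D) ∩ tipCylinder d (√M / K) (1 / K) := by
    rw [inter_comm, image_inter_preimage]
  rw [e1, hp.graph]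
  ext x
  simp only [tipCylinder, mem_ofPred_eq]
  rcases lt_or_ge ‖horiz x‖ (√M / K) with h | h
  · rw [extendGraph_of_lt h]
    constructor
    · rintro ⟨⟨-, -, h2⟩, h3⟩
      exact ⟨h3, h2⟩
    · rintro ⟨h3, h2⟩
      have := hp.nonneg _ (show horiz x ∈ Metric.ball 0 (√M / K) by simpa using h)
      have h4 : 0 < 1 / K := by positivity
      exact ⟨⟨h, by linarith, h2⟩, h3⟩
  · rw [extendGraph_of_le h]
    constructor
    · rintro ⟨⟨h1, -⟩, -⟩
      exact absurd h1 (not_lt.2 h)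
    · rintro ⟨h3, h2⟩
      exfalso
      have h5 : M / K ^ 2 ≤ ‖horiz x‖ ^ 2 := by
        rw [← hp.sq_radius]
        have := hp.one_le_M
        gcongr
      have h6 : K * (M / K ^ 2) = M / K := by field_simp
      have h7 : 1 / K ≤ M / K := by
        have := hp.one_le_M
        gcongr
      nlinarith [mul_le_mul_of_nonneg_left h5 hK.le]

/-- Inside the cylinder the boundary of `D` lies on the graph: points above it are in the open set
`D`, and by continuity of `w` points below it have a neighbourhood missing `D`. -/
lemma volume_inter_frontier
    (hp : IsAdmissibleKCurvaturePoint D p K L M δ Kminus Kplus w Φ) (hD : IsOpen D) :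
    volume (Φ ⁻¹' tipCylinder d (√M / K) (1 / K) ∩ frontier D) = 0 := by
  have hnull := volume_graph_eq_zero hp.measurable_extendGraph
  have hm : MeasurableSet {x : EuclideanSpace ℝ (Fin (d + 1)) |
      vert x = extendGraph w (√M / K) K (horiz x)} :=
    measurableSet_eq_fun continuous_vert.measurable
      (hp.measurable_extendGraph.comp continuous_horiz.measurable)
  rw [← Φ.measurePreserving_euclidean.measure_preimage hm.nullMeasurableSet] at hnull
  refine measure_mono_null ?_ hnull
  rintro x ⟨hxU, hxc, hxi⟩
  rw [hD.interior_eq] at hxi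
  have hxU' : Φ x ∈ tipCylinder d (√M / K) (1 / K) := hxU
  have hb := hxU'.1
  have key : ∀ z, Φ z ∈ tipCylinder d (√M / K) (1 / K) →
      (z ∈ D ↔ w (horiz (Φ z)) < vert (Φ z)) := by
    intro z hz
    have h1 : Φ z ∈ (Φ '' D) ∩ tipCylinder d (√M / K) (1 / K) ↔ z ∈ D :=
      ⟨fun h => (Φ.injective.mem_set_image).1 h.1, fun h => ⟨mem_image_of_mem Φ h, hz⟩⟩
    rw [← h1, hp.graph]
    exact ⟨fun h => h.2, fun h => ⟨hz, h⟩⟩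
  simp only [mem_preimage, mem_ofPred_eq, extendGraph_of_lt hb]
  refine le_antisymm (not_lt.1 fun h => hxi ((key x hxU').2 h)) (not_lt.1 fun h => ?_)
  have hwc : ContinuousAt w (horiz (Φ x)) :=
    hp.contDiffOn.continuousOn.continuousAt (Metric.isOpen_ball.mem_nhds (by simpa using hb))
  have hΦ : ContinuousAt Φ x := Φ.continuous.continuousAt
  have c1 : ContinuousAt (fun z => w (horiz (Φ z))) x :=
    ContinuousAt.comp (f := fun z => horiz (Φ z)) hwc
      (continuous_horiz.comp Φ.continuous).continuousAt
  have c2 : ContinuousAt (fun z => vert (Φ z)) x :=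
    (continuous_vert.comp Φ.continuous).continuousAt
  have ev := (c2.eventually_lt c1 h).and
    (((isOpen_tipCylinder d (√M / K) (1 / K)).preimage Φ.continuous).mem_nhds hxU')
  obtain ⟨z, ⟨hz1, hz2⟩, hzD⟩ := mem_closure_iff_nhds.1 hxc _ ev
  exact absurd ((key z hz2).1 hzD) (not_lt.2 (le_of_lt hz1))

/-- The tip never reaches the lateral wall below the lid: `K₋ |x'|² ≤ h - ε` and `K₋ ≥ K / M` force
`|x'|² < M / K² = b²`. Hence no cutoff is needed there. -/
lemma exists_compact_below
    (hp : IsAdmissibleKCurvaturePoint D p K L M δ Kminus Kplus w Φ) {ε : ℝ} (hε : 0 < ε) :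
    ∃ T, IsCompact T ∧ T ⊆ tipCylinder d (√M / K) (1 / K) ∧
      ∀ y, extendGraph w (√M / K) K (horiz y) < vert y → vert y ≤ 1 / K - ε → y ∈ T := by
  have hK := hp.K_pos
  have hKm := hp.Kminus_pos
  have hM := hp.one_le_M
  have hcyl : ∀ y : EuclideanSpace ℝ (Fin (d + 1)), Kminus * ‖horiz y‖ ^ 2 ≤ vert y →
      vert y ≤ 1 / K - ε → ‖horiz y‖ ^ 2 < (√M / K) ^ 2 := by
    intro y h1 h2
    rw [hp.sq_radius, lt_div_iff₀ (by positivity)]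
    have h3 : Kminus * ‖horiz y‖ ^ 2 < 1 / K := by linarith
    rw [lt_div_iff₀ hK] at h3
    have h4 : K ≤ M * Kminus := by
      have := hp.ratio_minus.1
      rw [inv_le_iff_one_le_mul₀ (by linarith), div_mul_eq_mul_div, le_div_iff₀ hK] at this
      linarith
    have h5 : 0 ≤ ‖horiz y‖ ^ 2 * K := by positivity
    nlinarith [mul_le_mul_of_nonneg_left h4 h5, mul_lt_mul_of_pos_left h3 (by linarith : 0 < M)]
  refine ⟨{y | Kminus * ‖horiz y‖ ^ 2 ≤ vert y ∧ vert y ≤ 1 / K - ε}, ?_, ?_, ?_⟩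
  · refine Metric.isCompact_of_isClosed_isBounded ?_ ?_
    · have h1 := continuous_horiz (d := d)
      have h2 := continuous_vert (d := d)
      exact (isClosed_le (by fun_prop) h2).inter (isClosed_le h2 continuous_const)
    · refine (Metric.isBounded_closedBall (x := (0 : EuclideanSpace ℝ (Fin (d + 1))))
        (r := √M / K + 1 / K)).subset ?_
      rintro y ⟨h1, h2⟩
      rw [mem_closedBall_zero_iff]
      have h0 : 0 ≤ vert y := le_trans (by positivity) h1
      have h3 := hcyl y h1 h2
      have h4 : 0 ≤ √M / K := by positivity
      refine abs_le_of_sq_le_sq' ?_ (by positivity) |>.2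
      rw [norm_sq_eq_horiz_add_vert]
      have h5 : 0 < 1 / K := by positivity
      nlinarith
  · rintro y ⟨h1, h2⟩
    have h0 : 0 ≤ vert y := le_trans (by positivity) h1
    have h5 : 0 < 1 / K := by positivity
    exact ⟨lt_of_pow_lt_pow_left₀ 2 (by positivity) (hcyl y h1 h2), by linarith, by linarith⟩
  · intro y h1 h2
    exact ⟨(hp.le_extendGraph _).trans h1.le, h2⟩

end IsAdmissibleKCurvaturePoint

end Geometry

/-! ### The exponential `u₀` and its direction. -/

section Exponential

variable {d : ℕ}

/-- Exponentials with isotropic frequency are harmonic. -/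
lemma harmonicAt_cexp_of_isotropic {ξ : Fin (d + 1) → ℂ} (hξ : ∑ j, ξ j ^ 2 = 0)
    (x : EuclideanSpace ℝ (Fin (d + 1))) :
    HarmonicAt (fun x : EuclideanSpace ℝ (Fin (d + 1)) =>
      Complex.exp (∑ j, ξ j * (x j : ℂ))) x := by
  let l : EuclideanSpace ℝ (Fin (d + 1)) →L[ℝ] ℂ :=
    ∑ j, (ξ j) • (Complex.ofRealCLM.comp (EuclideanSpace.proj j))
  have hl : ∀ x, l x = ∑ j, ξ j * (x j : ℂ) := fun x => by simp [l]
  let E : EuclideanSpace ℝ (Fin (d + 1)) → ℂ := fun x => Complex.exp (l x)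
  have hE : (fun x : EuclideanSpace ℝ (Fin (d + 1)) => Complex.exp (∑ j, ξ j * (x j : ℂ))) = E := by
    ext x
    simp only [E, hl]
  rw [hE]
  have hd : ∀ x, HasFDerivAt E (E x • l) x := fun x => l.hasFDerivAt.cexp
  have hfd : fderiv ℝ E = fun x => E x • l := funext fun x => (hd x).fderiv
  refine ⟨(Complex.contDiff_exp (𝕜 := ℝ)).contDiffAt.comp x l.contDiff.contDiffAt,
    Eventually.of_forall fun y => ?_⟩
  let b := EuclideanSpace.basisFun (Fin (d + 1)) ℝ
  rw [laplacian_eq_iteratedFDeriv_orthonormalBasis E b]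
  -- Summing over `i` gives `(ξ · ξ) E`, which vanishes by isotropy.
  have h2 : ∀ i, iteratedFDeriv ℝ 2 E y ![b i, b i] = E y * ξ i ^ 2 := fun i => by
    rw [iteratedFDeriv_two_apply, hfd, ((hd y).smul_const l).fderiv]
    have : l (b i) = ξ i := by
      rw [hl]
      simp [b, apply_ite]
    simp [this]
    ring
  simp [h2, ← Finset.mul_sum, hξ]

lemma vert_vHat (hd : 1 ≤ d) (a : EuclideanSpace ℝ (Fin (d + 1))) : vert (vHat a) = 0 := by
  have h0 : (Fin.last d) ≠ 0 := by
    intro h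
    have := congrArg Fin.val h
    simp at this
    omega
  unfold vHat
  split_ifs with h
  · simp [vert, h0]
  · rw [← inner_eLast, inner_smul_left, inner_sub_left, inner_smul_left,
      real_inner_self_eq_norm_sq, norm_eLast]
    simp

lemma norm_vHat (a : EuclideanSpace ℝ (Fin (d + 1))) : ‖vHat a‖ = 1 := by
  unfold vHat
  split_ifs with h
  · simp
  · rw [norm_smul, norm_inv, norm_norm, inv_mul_cancel₀ (norm_ne_zero_iff.2 h)]

lemma exists_eq_smul_vHat_add (a : EuclideanSpace ℝ (Fin (d + 1))) :
    ∃ q : ℝ, a = q • vHat a + vert a • eLast d := by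
  unfold vHat
  split_ifs with h
  · refine ⟨0, ?_⟩
    rw [zero_smul, zero_add, ← inner_eLast]
    exact sub_eq_zero.1 h
  · refine ⟨‖a - (inner ℝ a (eLast d)) • eLast d‖, ?_⟩
    rw [smul_inv_smul₀ (norm_ne_zero_iff.2 h), ← inner_eLast, sub_add_cancel]

/-- `ξ · ξ = 0` because `v̂` and `eₙ` are orthonormal; in the degenerate case this needs `e₁ ≠ eₙ`,
that is `d ≥ 1`. -/
lemma harmonicOnNhd_cgo (hd : 1 ≤ d) (τ : ℝ) (a : EuclideanSpace ℝ (Fin (d + 1)))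
    (s : Set (EuclideanSpace ℝ (Fin (d + 1)))) : HarmonicOnNhd (cgo τ a) s := by
  intro x _
  refine harmonicAt_cexp_of_isotropic ?_ x
  have h1 : ∑ j, (vHat a j) ^ 2 = 1 := by
    rw [← EuclideanSpace.real_norm_sq_eq, norm_vHat, one_pow]
  have h2 : ∑ j, (eLast d j) ^ 2 = 1 := by
    rw [← EuclideanSpace.real_norm_sq_eq, norm_eLast, one_pow]
  have h3 : ∑ j, vHat a j * eLast d j = 0 := by
    rw [← vert_vHat hd a, ← inner_eLast, PiLp.inner_apply]
    simp [mul_comm]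
  have e : ∀ j, cgoVector τ a j ^ 2 = -(τ : ℂ) ^ 2 * ((vHat a j ^ 2 : ℝ) : ℂ)
      + (τ : ℂ) ^ 2 * ((eLast d j ^ 2 : ℝ) : ℂ)
      - 2 * Complex.I * τ ^ 2 * ((vHat a j * eLast d j : ℝ) : ℂ) := fun j => by
    have hI := Complex.I_sq
    simp only [cgoVector]
    push_cast
    linear_combination (τ : ℂ) ^ 2 * (vHat a j : ℂ) ^ 2 * hI
  simp_rw [e]
  rw [Finset.sum_sub_distrib, Finset.sum_add_distrib, ← Finset.mul_sum, ← Finset.mul_sum,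
    ← Finset.mul_sum, ← Complex.ofReal_sum, ← Complex.ofReal_sum, ← Complex.ofReal_sum, h1, h2, h3]
  simp

end Exponential

/-! ### Pointwise bounds from the Hölder norm. -/

section HolderNorm

variable {d : ℕ} {α : ℝ} {S : Set (EuclideanSpace ℝ (Fin (d + 1)))}
  {f : EuclideanSpace ℝ (Fin (d + 1)) → ℝ}

lemma norm_gradient_le_of_holderNorm (hf : holderNorm α S f ≠ ⊤)
    {x : EuclideanSpace ℝ (Fin (d + 1))} (hx : x ∈ S) :
    ‖gradient f x‖ ≤ (holderNorm α S f).toReal := by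
  have h : ‖gradient f x‖ₑ ≤ holderNorm α S f := by
    unfold holderNorm
    refine le_trans ?_ (le_self_add (a := _) (b := _))
    refine le_trans ?_ (le_add_self (a := _) (b := _))
    exact le_iSup₂ (f := fun x (_ : x ∈ S) => ‖gradient f x‖ₑ) x hx
  rw [← toReal_enorm]
  exact ENNReal.toReal_mono hf h

lemma norm_gradient_sub_le_of_holderNorm (hα : 0 < α) (hf : holderNorm α S f ≠ ⊤)
    {x y : EuclideanSpace ℝ (Fin (d + 1))} (hx : x ∈ S) (hy : y ∈ S) :
    ‖gradient f x - gradient f y‖ ≤ (holderNorm α S f).toReal * ‖x - y‖ ^ α := by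
  rcases eq_or_ne x y with rfl | hxy
  · simp [Real.zero_rpow hα.ne']
  have h : edist (gradient f x) (gradient f y) / edist x y ^ α ≤ holderNorm α S f := by
    unfold holderNorm
    refine le_trans ?_ (le_add_self (a := _) (b := _))
    exact le_trans (le_iSup₂ (f := fun y (_ : y ∈ S) =>
      edist (gradient f x) (gradient f y) / edist x y ^ α) y hy)
      (le_iSup₂ (f := fun x (_ : x ∈ S) => ⨆ y ∈ S,
        edist (gradient f x) (gradient f y) / edist x y ^ α) x hx)
  have h0 : edist x y ≠ 0 := by simpa using hxy
  rw [ENNReal.div_le_iff (by simp [ENNReal.rpow_eq_zero_iff, h0, edist_ne_top])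
    (ENNReal.rpow_ne_top_of_nonneg hα.le (edist_ne_top _ _))] at h
  have := ENNReal.toReal_mono
    (ENNReal.mul_ne_top hf (ENNReal.rpow_ne_top_of_nonneg hα.le (edist_ne_top _ _))) h
  rwa [ENNReal.toReal_mul, ← ENNReal.toReal_rpow, ← dist_edist, ← dist_edist, dist_eq_norm,
    dist_eq_norm] at this

end HolderNorm

/-! ### The estimate for large `τ / K`. -/

section Estimate

variable {d : ℕ}

/-- Compares `τ` times the volume scale `h^n` of the tip with the Gaussian amplitude, so that the
amplitude can be divided out. The quotient is the power `(τ / K)^((n+1)/2)`; the power of `π` is at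
least `1`. -/
lemma mul_pow_le_gaussian_mul {τ K : ℝ} (hτ : 0 < τ) (hK : 0 < K) :
    τ * (1 / K) ^ (d + 1) ≤ (Real.pi / (τ * K)) ^ ((d : ℝ) / 2) * (τ / K) ^ ((d : ℝ) / 2 + 1) := by
  have h1 : Real.pi / (τ * K) = Real.pi * ((1 / K) ^ 2 / (τ / K)) := by field_simp
  have ht : 0 < τ / K := by positivity
  have h2 : ((1 / K) ^ 2) ^ ((d : ℝ) / 2) = (1 / K) ^ d := by
    rw [← Real.rpow_natCast (1 / K) 2, ← Real.rpow_mul (by positivity), ← Real.rpow_natCast]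
    congr 1
    push_cast
    ring
  rw [h1, Real.mul_rpow Real.pi_pos.le (by positivity), Real.div_rpow (by positivity) ht.le, h2,
    Real.rpow_add ht, Real.rpow_one]
  have h3 : 1 ≤ Real.pi ^ ((d : ℝ) / 2) :=
    Real.one_le_rpow (by linarith [Real.pi_gt_three]) (by positivity)
  have h4 : 0 < (τ / K) ^ ((d : ℝ) / 2) := Real.rpow_pos_of_pos ht _
  have h5 : Real.pi ^ ((d : ℝ) / 2) * ((1 / K) ^ d / (τ / K) ^ ((d : ℝ) / 2)) *
      ((τ / K) ^ ((d : ℝ) / 2) * (τ / K)) = Real.pi ^ ((d : ℝ) / 2) * (τ * (1 / K) ^ (d + 1)) := by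
    rw [pow_succ]
    field_simp
  rw [h5]
  exact le_mul_of_one_le_left (by positivity) h3

lemma gaussian_rescale {τ K Km : ℝ} (hτ : 0 < τ) (hK : 0 < K) (hKm : 0 < Km) (r m : ℝ)
    (hr : 0 < r) :
    (r * Real.pi / (τ * Km)) ^ m = (Real.pi / (τ * K)) ^ m * (r * (K / Km)) ^ m := by
  rw [← Real.mul_rpow (by positivity) (by positivity)]
  congr 1
  field_simp

set_option maxHeartbeats 1000000 in
/-- The estimate when the curvature ratio is bounded and the frequency is large. -/
lemma exists_estimate_of_large_frequency (hd : 1 ≤ d) {η α : ℝ} (hη1 : η ≠ 1) (hα0 : 0 < α)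
    (hα1 : α ≤ 1) : ∃ C : ℝ, 0 ≤ C ∧ ∀ {S : Set (EuclideanSpace ℝ (Fin (d + 1)))}
      {a e : EuclideanSpace ℝ (Fin (d + 1)) → EuclideanSpace ℝ (Fin (d + 1))}
      {g : EuclideanSpace ℝ (Fin (d + 1))} {w : EuclideanSpace ℝ (Fin d) → ℝ}
      {K Km Kp τ A B : ℝ}, 0 < Km → Km ≤ K → K ≤ Kp → K ≤ 4 * Km → Measurable w →
      (∀ y, Km * ‖y‖ ^ 2 ≤ w y) → (∀ y, w y ≤ Kp * ‖y‖ ^ 2) →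
      S = {x | w (horiz x) < vert x ∧ vert x < 1 / K} → IsOpen S → 0 < τ → 1 < τ / K →
      8 ^ ((d : ℝ) / 2) * Real.exp ((1 - τ / K) / 2) ≤ Real.exp (-(τ / (4 * K))) / 2 →
      0 ≤ A → 0 ≤ B → ContinuousOn a S → ContinuousOn e S →
      (∀ x ∈ S, ‖a x - g‖ ≤ A * ‖x‖ ^ α) → (∀ x ∈ S, ∀ y ∈ S, ‖a x - a y‖ ≤ A * ‖x - y‖ ^ α) →
      (∀ x ∈ S, ∀ y ∈ S, ‖e x - e y‖ ≤ B * ‖x - y‖ ^ α) → ‖g‖ ≤ A →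
      (∀ φ : EuclideanSpace ℝ (Fin (d + 1)) → ℝ, ContDiff ℝ ∞ φ →
        (∃ ε > 0, ∀ x, 1 / K - ε ≤ vert x → φ x = 0) →
        (∫ x in S, inner ℝ (η • a x - e x) (gradient φ x) = 0) ∧
        ∀ v z, ∫ x in S, inner ℝ (a x - e x) (fderiv ℝ φ x v • z - fderiv ℝ φ x z • v) = 0) →
      ‖g‖ ≤ 2 * (A * (((K / Km) ^ ((d : ℝ) / 2) - (K / Kp) ^ ((d : ℝ) / 2))
            * Real.exp (τ / (4 * K))))
        + C * (A * ((1 / K) ^ α * (τ / K) ^ ((d : ℝ) / 2 + 1) * Real.exp (τ / (4 * K))))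
        + C * ((A + B) * ((1 / K) ^ α * (τ / K) ^ ((d : ℝ) / 2 + 1)
            * Real.exp (τ * (1 / (4 * K) - 1 / K)))) := by
  obtain ⟨c, hc, hcut⟩ := exists_cutoff
  set V := volume.real (Metric.ball (0 : EuclideanSpace ℝ (Fin (d + 1))) 1) * 3 ^ (d + 1) with hV
  have hV0 : 0 ≤ V := by positivity
  have hX : 0 < |η - 1| := abs_pos.2 (sub_ne_zero.2 hη1)
  refine ⟨48 * V + 24 * c * (|η| + 2) * Real.exp 1 * V / |η - 1|, by positivity, ?_⟩
  intro S a e g w K Km Kp τ A B hKm hmK hKp hK4 hw hwm hwp hS hSo hτ ht hsmall hA hB hac hec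
    hag haa hee hgA H
  have hK : 0 < K := hKm.trans_le hmK
  have hKp0 : 0 < Kp := hK.trans_le hKp
  set h := 1 / K with hh
  have hh0 : 0 < h := by positivity
  have hτh : τ * h = τ / K := by rw [hh]; ring
  obtain ⟨ψ, hψ, hanti, hψ0, hψ1, hone, hzero, hder⟩ := hcut τ h hτ
  -- `K ≤ 4 Km` gives `|x'|² ≤ 4 h²` on the tip, so its diameter is at most `6h` and its volume is
  -- `O(h^n)`, with constants independent of `M`.
  have hball : ∀ x ∈ S, ‖x‖ ≤ 3 * h ∧ 0 ≤ vert x := by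
    intro x hx
    rw [hS] at hx
    have h1 := (hwm (horiz x)).trans hx.1.le
    have h0 : 0 ≤ vert x := le_trans (by positivity) h1
    refine ⟨abs_le_of_sq_le_sq' ?_ (by positivity) |>.2, h0⟩
    have h2 : K * ‖horiz x‖ ^ 2 ≤ 4 * vert x := by
      nlinarith [mul_le_mul_of_nonneg_right hK4 (sq_nonneg ‖horiz x‖)]
    have h3 : ‖horiz x‖ ^ 2 ≤ 4 * h ^ 2 := by
      have : h * (K * ‖horiz x‖ ^ 2) = ‖horiz x‖ ^ 2 := by rw [hh]; field_simp
      nlinarith [mul_le_mul_of_nonneg_left h2 hh0.le, mul_lt_mul_of_pos_left hx.2 hh0]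
    rw [norm_sq_eq_horiz_add_vert]
    nlinarith [hx.2]
  have hSb : Bornology.IsBounded S := Metric.isBounded_closedBall.subset
    (t := Metric.closedBall 0 (3 * h)) fun x hx => by simpa using (hball x hx).1
  have hSfin := hSb.measure_lt_top (μ := volume)
  have hvol : volume.real S ≤ V * h ^ (d + 1) := by
    have hsub : S ⊆ Metric.closedBall 0 (3 * h) := fun x hx => by simpa using (hball x hx).1
    refine (measureReal_mono hsub (Metric.isBounded_closedBall.measure_lt_top.ne)).trans ?_
    rw [measureReal_def, Measure.addHaar_closedBall _ _ (by positivity), finrank_euclideanSpace_fin,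
      ENNReal.toReal_mul, ENNReal.toReal_ofReal (by positivity), hV, measureReal_def, mul_pow]
    exact le_of_eq (by ring)
  set y := h ^ α with hy
  have hy0 : 0 ≤ y := by positivity
  have six : ∀ s, 0 ≤ s → s ≤ 6 * h → s ^ α ≤ 6 * y := by
    intro s hs hs6
    refine (Real.rpow_le_rpow hs hs6 hα0.le).trans ?_
    rw [Real.mul_rpow (by norm_num) hh0.le]
    have : (6 : ℝ) ^ α ≤ 6 := by
      conv_rhs => rw [← Real.rpow_one 6]
      exact Real.rpow_le_rpow_of_exponent_le (by norm_num) hα1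
    gcongr
  have osc : ∀ x ∈ S, ∀ z ∈ S, ‖x - z‖ ^ α ≤ 6 * y := fun x hx z hz =>
    six _ (norm_nonneg _) ((norm_sub_le _ _).trans (by linarith [(hball x hx).1, (hball z hz).1]))
  have hag' : ∀ x ∈ S, ‖a x - g‖ ≤ 6 * y * A := fun x hx => (hag x hx).trans (by
    rw [mul_comm]
    exact mul_le_mul_of_nonneg_right (six _ (norm_nonneg _) (by linarith [(hball x hx).1])) hA)
  have haa' : ∀ x ∈ S, ∀ z ∈ S, ‖a x - a z‖ ≤ 6 * y * A := fun x hx z hz =>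
    (haa x hx z hz).trans (by
      rw [mul_comm]
      exact mul_le_mul_of_nonneg_right (osc x hx z hz) hA)
  have hee' : ∀ x ∈ S, ∀ z ∈ S, ‖e x - e z‖ ≤ 6 * y * B := fun x hx z hz =>
    (hee x hx z hz).trans (by
      rw [mul_comm]
      exact mul_le_mul_of_nonneg_right (osc x hx z hz) hB)
  have haxis : ∀ r, 0 < r → r < h → r • eLast d ∈ S := by
    intro r h0 h1
    have e1 : vert (r • eLast d) = r := by
      rw [← vertL_apply, map_smul, vertL_apply, vert_eLast, smul_eq_mul, mul_one]
    have e2 : horiz (r • eLast d) = 0 := by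
      ext i
      simp [horiz, eLast]
    rw [hS]
    refine ⟨?_, by rwa [e1]⟩
    rw [e1, e2]
    refine (hwp 0).trans_lt ?_
    simpa using h0
  have integ : ∀ {F : EuclideanSpace ℝ (Fin (d + 1)) → EuclideanSpace ℝ (Fin (d + 1))} {δ : ℝ},
      ContinuousOn F S → (∀ x ∈ S, ∀ z ∈ S, ‖F x - F z‖ ≤ δ) → IntegrableOn F S := by
    intro F δ hF hosc
    have hx0 := haxis (h / 2) (by positivity) (by linarith)
    refine IntegrableOn.of_bound hSfin (hF.aestronglyMeasurable hSo.measurableSet)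
      (δ + ‖F ((h / 2) • eLast d)‖) ?_
    filter_upwards [ae_restrict_mem hSo.measurableSet] with x hx
    have := norm_le_norm_add_norm_sub' (F x) (F ((h / 2) • eLast d))
    linarith [hosc x hx _ hx0]
  obtain ⟨q, hq⟩ := exists_eq_smul_vHat_add g
  have hvn := vert_vHat hd g
  have core := abs_main_integral_le (η := η) hSo hSb (fun x hx => (hball x hx).2) haxis hτ
    (by rw [hτh]; exact ht) hψ hanti hψ0 hψ1 hone hzero hder (norm_vHat g) hvn hq
    (integ hac haa') (integ hec hee') hag' haa' hee'
    (fun φ h1 h2 => (H φ h1 h2).1) (fun φ h1 h2 => (H φ h1 h2).2 _ _)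
  have hhv : ‖horiz (vHat g)‖ = 1 := by
    have := norm_sq_eq_horiz_add_vert (vHat g)
    rw [hvn, norm_vHat, one_pow] at this
    have h2 : ‖horiz (vHat g)‖ ^ 2 = 1 := by linarith
    exact (pow_eq_one_iff_of_nonneg (norm_nonneg _) (by norm_num)).1 h2
  have hinner : ∀ x, inner ℝ (vHat g) x = inner ℝ (horiz (vHat g)) (horiz x) := fun x => by
    rw [inner_eq_horiz_add_vert, hvn, zero_mul, add_zero]
  have hosci := abs_integral_cos_sub_le hw hKm hmK hKp hwm hwp hτ hψ.continuous.measurable hψ0 hψ1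
    hone (fun r hr => by
      obtain ⟨ε, hε, hz⟩ := hzero
      exact hz r (by linarith)) hhv hS hSfin.ne
  simp only [← hinner] at hosci
  set J := ∫ x in S, ψ (vert x) * Real.exp (-τ * vert x) * Real.cos (τ * inner ℝ (vHat g) x)
  set m := (d : ℝ) / 2 with hm
  have hm0 : 0 ≤ m := by positivity
  set P := (Real.pi / (τ * K)) ^ m with hP
  have hP0 : 0 < P := Real.rpow_pos_of_pos (by positivity) _
  set Δ := (K / Km) ^ m - (K / Kp) ^ m with hΔ
  have hΔ0 : 0 ≤ Δ := sub_nonneg.2 (Real.rpow_le_rpow (by positivity)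
    (div_le_div_of_nonneg_left hK.le hKm (hmK.trans hKp)) hm0)
  -- The cutoff error is at most half of the main term by `hsmall`, where `8` bounds `2K / Km`; the
  -- shape error is `P Δ`.
  have hJ : P * (Real.exp (-(τ / (4 * K))) / 2 - Δ) ≤ τ * |J| := by
    have r1 := gaussian_rescale hτ hK hKm 1 m one_pos
    have r2 := gaussian_rescale hτ hK hKp0 1 m one_pos
    have r3 := gaussian_rescale hτ hK hKm 2 m two_pos
    simp only [one_mul] at r1 r2
    rw [r1, r2, r3, ← hP, hτh] at hosci
    have r4 : (2 * (K / Km)) ^ m ≤ 8 ^ m := by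
      refine Real.rpow_le_rpow (by positivity) ?_ hm0
      have : K / Km ≤ 4 := by rwa [div_le_iff₀ hKm]
      linarith
    have r5 := (abs_le.1 hosci).1
    have r6 : τ * (P * Real.exp (-(τ / (4 * K))) / τ) = P * Real.exp (-(τ / (4 * K))) := by
      field_simp
    have r7 : τ * ((P * (K / Km) ^ m - P * (K / Kp) ^ m) / τ +
        Real.exp ((1 - τ / K) / 2) * (P * (2 * (K / Km)) ^ m) / τ)
        = P * Δ + P * (Real.exp ((1 - τ / K) / 2) * (2 * (K / Km)) ^ m) := by
      rw [hΔ]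
      field_simp
    have r8 : Real.exp ((1 - τ / K) / 2) * (2 * (K / Km)) ^ m
        ≤ Real.exp (-(τ / (4 * K))) / 2 :=
      le_trans (by rw [mul_comm]; gcongr) hsmall
    have r9 := mul_le_mul_of_nonneg_left r8 hP0.le
    have r10 := mul_le_mul_of_nonneg_left r5 hτ.le
    have r11 := mul_le_mul_of_nonneg_left (le_abs_self J) hτ.le
    rw [mul_neg, r7, mul_sub τ J, r6] at r10
    linarith
  -- One factor `|g|` is cancelled below, so `g = 0` is treated apart.
  rcases (norm_nonneg g).eq_or_lt with hg0 | hg0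
  · rw [← hg0]
    have : 0 ≤ K / Km := by positivity
    positivity
  set N := ‖g‖ with hN
  set Z := y * (24 * V * A + 12 * c * (|η| + 2) * Real.exp 1 * V / |η - 1| * Real.exp (-(τ / K))
    * (A + B)) with hZ
  have hZ0 : 0 ≤ Z := by positivity
  have s1 : τ * (N * |J|) ≤ Z * (τ * h ^ (d + 1)) := by
    have hE : Real.exp (1 - τ * h) = Real.exp 1 * Real.exp (-(τ / K)) := by
      rw [← Real.exp_add, hτh]
      ring_nf
    have b1 : (|η| + 1) * (6 * y * A) + 2 * (6 * y * B) ≤ (|η| + 2) * (6 * y * (A + B)) := by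
      nlinarith [mul_nonneg hy0 hA, mul_nonneg hy0 hB, abs_nonneg η,
        mul_nonneg (abs_nonneg η) (mul_nonneg hy0 hB)]
    have b2 : |η - 1| * (τ * N ^ 2 * |J|)
        ≤ (|η - 1| * (4 * τ * N * (6 * y * A)) + 2 * c * τ * N * Real.exp (1 - τ * h)
          * ((|η| + 2) * (6 * y * (A + B)))) * (V * h ^ (d + 1)) := by
      refine core.trans ?_
      gcongr
    have b3 : (|η - 1| * (4 * τ * N * (6 * y * A)) + 2 * c * τ * N * Real.exp (1 - τ * h)
          * ((|η| + 2) * (6 * y * (A + B)))) * (V * h ^ (d + 1))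
        = (|η - 1| * N) * (Z * (τ * h ^ (d + 1))) := by
      rw [hE, hZ]
      field_simp
      ring
    have b4 : |η - 1| * (τ * N ^ 2 * |J|) = (|η - 1| * N) * (τ * (N * |J|)) := by ring
    rw [b3, b4] at b2
    exact le_of_mul_le_mul_left b2 (by positivity)
  have s2 : τ * h ^ (d + 1) ≤ P * (τ / K) ^ (m + 1) := mul_pow_le_gaussian_mul hτ hK
  have s3 : N * (Real.exp (-(τ / (4 * K))) / 2 - Δ) ≤ Z * (τ / K) ^ (m + 1) := by
    have q1 := mul_le_mul_of_nonneg_left hJ hg0.le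
    have q2 := mul_le_mul_of_nonneg_left s2 hZ0
    refine le_of_mul_le_mul_left ?_ hP0
    calc P * (N * (Real.exp (-(τ / (4 * K))) / 2 - Δ))
        = N * (P * (Real.exp (-(τ / (4 * K))) / 2 - Δ)) := by ring
      _ ≤ N * (τ * |J|) := q1
      _ = τ * (N * |J|) := by ring
      _ ≤ _ := s1.trans q2
      _ = P * (Z * (τ / K) ^ (m + 1)) := by ring
  set E := Real.exp (τ / (4 * K)) with hEd
  have hE0 : 0 < E := Real.exp_pos _
  have hEi : E * Real.exp (-(τ / (4 * K))) = 1 := by rw [← Real.exp_add, add_neg_cancel, Real.exp_zero]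
  have hE3 : Real.exp (τ * (1 / (4 * K) - h)) = E * Real.exp (-(τ / K)) := by
    rw [hEd, ← Real.exp_add]
    congr 1
    rw [hh]
    ring
  -- Multiplying by `2 exp (τ / (4K))` normalizes the main term to `|g|` and puts the growth into
  -- the error terms.
  have s4 := mul_le_mul_of_nonneg_left s3 (by positivity : 0 ≤ 2 * E)
  have s5 : 2 * E * (N * (Real.exp (-(τ / (4 * K))) / 2 - Δ)) = N - 2 * (N * (Δ * E)) := by
    linear_combination N * hEi
  rw [s5] at s4
  have s6 : N * (Δ * E) ≤ A * (Δ * E) := mul_le_mul_of_nonneg_right hgA (by positivity)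
  rw [hE3]
  set T := (τ / K) ^ (m + 1)
  have hT : 0 ≤ T := by positivity
  set F := Real.exp (-(τ / K))
  set κ := 12 * c * (|η| + 2) * Real.exp 1 * V / |η - 1| with hκ
  have hκ0 : 0 ≤ κ := by positivity
  have hκ2 : 24 * c * (|η| + 2) * Real.exp 1 * V / |η - 1| = 2 * κ := by rw [hκ]; ring
  rw [hκ2]
  have s7 : 2 * E * (Z * T) = 48 * V * (A * (y * T * E)) + 2 * κ * ((A + B) * (y * T * (E * F))) := by
    rw [hZ]
    ring
  rw [s7] at s4
  have p1 : 0 ≤ A * (y * T * E) := by positivity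
  have p2 : 0 ≤ (A + B) * (y * T * (E * F)) := by positivity
  have p3 := mul_nonneg hκ0 p1
  have p4 := mul_nonneg hV0 p2
  linarith

end Estimate

/-! ### Return to the original coordinates and comparison of weights. -/

section Assembly

variable {d : ℕ}

lemma InnerProductSpace.HarmonicOnNhd.continuousOn_gradient {f : EuclideanSpace ℝ (Fin (d + 1)) → ℝ}
    {S : Set (EuclideanSpace ℝ (Fin (d + 1)))} (hS : IsOpen S) (hf : HarmonicOnNhd f S) :
    ContinuousOn (gradient f) S :=
  _root_.continuousOn_gradient hS
    fun x hx => ((hf x hx).1.of_le (by norm_num)).contDiffWithinAt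

namespace IsAdmissibleKCurvaturePoint

variable {D : Set (EuclideanSpace ℝ (Fin (d + 1)))} {p : EuclideanSpace ℝ (Fin (d + 1))}
  {K L M δ Kminus Kplus : ℝ} {w : EuclideanSpace ℝ (Fin d) → ℝ}
  {Φ : EuclideanSpace ℝ (Fin (d + 1)) ≃ᵃⁱ[ℝ] EuclideanSpace ℝ (Fin (d + 1))}

lemma mem_cylinder (hp : IsAdmissibleKCurvaturePoint D p K L M δ Kminus Kplus w Φ) :
    p ∈ Φ ⁻¹' tipCylinder d (√M / K) (1 / K) := by
  have hK := hp.K_pos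
  have hM : 0 < M := zero_lt_one.trans_le hp.one_le_M
  have h1 : horiz (0 : EuclideanSpace ℝ (Fin (d + 1))) = 0 := by
    ext i
    simp [horiz]
  have h2 : vert (0 : EuclideanSpace ℝ (Fin (d + 1))) = 0 := by simp [vert]
  rw [mem_preimage, hp.map_point]
  refine ⟨?_, ?_, ?_⟩
  · rw [h1, norm_zero]
    positivity
  · rw [h2]
    simpa using hK
  · rw [h2]
    positivity

lemma isOpen_cylinder (Φ : EuclideanSpace ℝ (Fin (d + 1)) ≃ᵃⁱ[ℝ] EuclideanSpace ℝ (Fin (d + 1)))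
    (b h : ℝ) : IsOpen (Φ ⁻¹' tipCylinder d b h) :=
  (isOpen_tipCylinder d b h).preimage Φ.continuous

lemma nhdsWithin_inter_eq (hp : IsAdmissibleKCurvaturePoint D p K L M δ Kminus Kplus w Φ) :
    𝓝[Φ ⁻¹' tipCylinder d (√M / K) (1 / K) ∩ D] p = 𝓝[D] p := by
  rw [inter_comm]
  exact nhdsWithin_inter_of_mem' (mem_nhdsWithin_of_mem_nhds
    ((isOpen_cylinder Φ _ _).mem_nhds hp.mem_cylinder))

lemma neBot_nhdsWithin (hp : IsAdmissibleKCurvaturePoint D p K L M δ Kminus Kplus w Φ) :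
    (𝓝[D] p).NeBot :=
  mem_closure_iff_nhdsWithin_neBot.1 hp.mem_frontier.1

/-- The bound passes to the limit: `p` is interior to the cylinder, so approach within `D` is
eventually within the tip, and the filter is nontrivial because `p ∈ closure D`. -/
lemma norm_le_of_tendsto {α : ℝ} {f : EuclideanSpace ℝ (Fin (d + 1)) → ℝ}
    {G : EuclideanSpace ℝ (Fin (d + 1))}
    (hp : IsAdmissibleKCurvaturePoint D p K L M δ Kminus Kplus w Φ)
    (hf : holderNorm α (Φ ⁻¹' tipCylinder d (√M / K) (1 / K) ∩ D) f ≠ ⊤)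
    (hG : Tendsto (gradient f) (𝓝[D] p) (𝓝 G)) :
    ‖G‖ ≤ (holderNorm α (Φ ⁻¹' tipCylinder d (√M / K) (1 / K) ∩ D) f).toReal := by
  have := hp.neBot_nhdsWithin
  refine le_of_tendsto hG.norm ?_
  rw [← hp.nhdsWithin_inter_eq]
  filter_upwards [self_mem_nhdsWithin] with x hx using norm_gradient_le_of_holderNorm hf hx

lemma norm_sub_le_of_tendsto {α : ℝ} (hα : 0 < α) {f : EuclideanSpace ℝ (Fin (d + 1)) → ℝ}
    {G : EuclideanSpace ℝ (Fin (d + 1))}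
    (hp : IsAdmissibleKCurvaturePoint D p K L M δ Kminus Kplus w Φ)
    (hf : holderNorm α (Φ ⁻¹' tipCylinder d (√M / K) (1 / K) ∩ D) f ≠ ⊤)
    (hG : Tendsto (gradient f) (𝓝[D] p) (𝓝 G)) {x : EuclideanSpace ℝ (Fin (d + 1))}
    (hx : x ∈ Φ ⁻¹' tipCylinder d (√M / K) (1 / K) ∩ D) :
    ‖gradient f x - G‖ ≤
      (holderNorm α (Φ ⁻¹' tipCylinder d (√M / K) (1 / K) ∩ D) f).toReal * ‖x - p‖ ^ α := by
  have := hp.neBot_nhdsWithin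
  have h1 : Tendsto (fun y => (holderNorm α (Φ ⁻¹' tipCylinder d (√M / K) (1 / K) ∩ D) f).toReal
      * ‖x - y‖ ^ α) (𝓝[D] p) (𝓝 ((holderNorm α (Φ ⁻¹' tipCylinder d (√M / K) (1 / K) ∩ D) f).toReal
      * ‖x - p‖ ^ α)) := by
    refine Tendsto.const_mul _ (Tendsto.rpow_const ?_ (Or.inr hα.le))
    exact ((continuous_const.sub continuous_id).norm.tendsto p).mono_left nhdsWithin_le_nhds
  refine le_of_tendsto_of_tendsto (tendsto_const_nhds.sub hG).norm h1 ?_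
  rw [← hp.nhdsWithin_inter_eq]
  filter_upwards [self_mem_nhdsWithin] with y hy
    using norm_gradient_sub_le_of_holderNorm hα hf hx hy

end IsAdmissibleKCurvaturePoint

/-- The estimate in the regime of large frequency, in terms of the Hölder norms. -/
lemma exists_estimate_holderNorm (hd : 1 ≤ d) {η α : ℝ} (hη1 : η ≠ 1) (hα0 : 0 < α)
    (hα1 : α ≤ 1) : ∃ C : ℝ, 0 ≤ C ∧ ∀ {Ω D U : Set (EuclideanSpace ℝ (Fin (d + 1)))}
      {p : EuclideanSpace ℝ (Fin (d + 1))} {K L M δ Kminus Kplus : ℝ}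
      {w : EuclideanSpace ℝ (Fin d) → ℝ}
      {Φ : EuclideanSpace ℝ (Fin (d + 1)) ≃ᵃⁱ[ℝ] EuclideanSpace ℝ (Fin (d + 1))}
      {u ui ue : EuclideanSpace ℝ (Fin (d + 1)) → ℝ} {G : EuclideanSpace ℝ (Fin (d + 1))} {τ : ℝ},
      IsOpen Ω → IsOpen D → closure D ⊆ Ω →
      IsAdmissibleKCurvaturePoint D p K L M δ Kminus Kplus w Φ →
      U = Φ ⁻¹' tipCylinder d (√M / K) (1 / K) → U ⊆ Ω →
      IsConductivitySolution Ω D η u → HarmonicOnNhd ui D → ui =ᵐ[volume.restrict D] u →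
      HarmonicOnNhd ue ((Ω \ closure D) ∪ U) → ue =ᵐ[volume.restrict (Ω \ closure D)] u →
      Tendsto (gradient ui) (𝓝[D] p) (𝓝 G) → 0 < τ → K ≤ 4 * Kminus → 1 < τ / K →
      8 ^ ((d : ℝ) / 2) * Real.exp ((1 - τ / K) / 2) ≤ Real.exp (-(τ / (4 * K))) / 2 →
      holderNorm α (U ∩ D) ui ≠ ⊤ → holderNorm α (U ∩ D) ue ≠ ⊤ →
      ‖G‖ ≤ 2 * ((holderNorm α (U ∩ D) ui).toReal
            * (((K / Kminus) ^ ((d : ℝ) / 2) - (K / Kplus) ^ ((d : ℝ) / 2))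
            * Real.exp (τ / (4 * K))))
        + C * ((holderNorm α (U ∩ D) ui).toReal
            * ((1 / K) ^ α * (τ / K) ^ ((d : ℝ) / 2 + 1) * Real.exp (τ / (4 * K))))
        + C * (((holderNorm α (U ∩ D) ui).toReal + (holderNorm α (U ∩ D) ue).toReal)
            * ((1 / K) ^ α * (τ / K) ^ ((d : ℝ) / 2 + 1)
            * Real.exp (τ * (1 / (4 * K) - 1 / K)))) := by
  obtain ⟨C, hC, H⟩ := exists_estimate_of_large_frequency hd hη1 hα0 hα1
  refine ⟨C, hC, ?_⟩
  intro Ω D U p K L M δ Kminus Kplus w Φ u ui ue G τ hΩ hD hDΩ hp hU hUΩ hu hui huiu hue hueu hG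
    hτ hK4 ht hsmall hfi hfe
  have hUo : IsOpen U := hU ▸ IsAdmissibleKCurvaturePoint.isOpen_cylinder Φ _ _
  have himg : Φ '' (U ∩ D)
      = {x | extendGraph w (√M / K) K (horiz x) < vert x ∧ vert x < 1 / K} := by
    rw [hU, hp.image_inter]
  have hΦU : Φ '' U = tipCylinder d (√M / K) (1 / K) := by
    rw [hU, image_preimage_eq _ Φ.surjective]
  have hsymm : ∀ y ∈ Φ '' (U ∩ D), Φ.symm y ∈ U ∩ D := by
    rintro _ ⟨x, hx, rfl⟩
    rwa [Φ.symm_apply_apply]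
  have hdist : ∀ x y, ‖Φ.symm x - Φ.symm y‖ = ‖x - y‖ := fun x y => by
    rw [← dist_eq_norm, ← dist_eq_norm, Φ.symm.dist_map]
  have hp0 : p = Φ.symm 0 := by rw [← hp.map_point, Φ.symm_apply_apply]
  have hR : ∀ x y, ‖Φ.linearIsometryEquiv x - Φ.linearIsometryEquiv y‖ = ‖x - y‖ := fun x y => by
    rw [← map_sub, LinearIsometryEquiv.norm_map]
  have hcont : ∀ {f : EuclideanSpace ℝ (Fin (d + 1)) → ℝ}, HarmonicOnNhd f (U ∩ D) →
      ContinuousOn (fun y => Φ.linearIsometryEquiv (gradient f (Φ.symm y))) (Φ '' (U ∩ D)) :=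
    fun {f} hf => Φ.linearIsometryEquiv.continuous.comp_continuousOn
      ((HarmonicOnNhd.continuousOn_gradient (hUo.inter hD) hf).comp Φ.symm.continuous.continuousOn hsymm)
  have hosc : ∀ {f : EuclideanSpace ℝ (Fin (d + 1)) → ℝ}, holderNorm α (U ∩ D) f ≠ ⊤ →
      ∀ x ∈ Φ '' (U ∩ D), ∀ y ∈ Φ '' (U ∩ D),
      ‖Φ.linearIsometryEquiv (gradient f (Φ.symm x)) - Φ.linearIsometryEquiv (gradient f (Φ.symm y))‖
        ≤ (holderNorm α (U ∩ D) f).toReal * ‖x - y‖ ^ α := by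
    intro f hf x hx y hy
    rw [hR, ← hdist x y]
    exact norm_gradient_sub_le_of_holderNorm hα0 hf (hsymm x hx) (hsymm y hy)
  have hbase : ∀ x ∈ Φ '' (U ∩ D), ‖Φ.linearIsometryEquiv (gradient ui (Φ.symm x))
      - Φ.linearIsometryEquiv G‖ ≤ (holderNorm α (U ∩ D) ui).toReal * ‖x‖ ^ α := by
    intro x hx
    have h1 : ‖x‖ = ‖Φ.symm x - p‖ := by rw [hp0, hdist, sub_zero]
    rw [hR, h1]
    subst hU
    exact hp.norm_sub_le_of_tendsto hα0 hfi hG (hsymm x hx)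
  have hGle : ‖Φ.linearIsometryEquiv G‖ ≤ (holderNorm α (U ∩ D) ui).toReal := by
    rw [LinearIsometryEquiv.norm_map]
    subst hU
    exact hp.norm_le_of_tendsto hfi hG
  have hnull : volume (U ∩ frontier D) = 0 := by
    rw [hU]
    exact hp.volume_inter_frontier hD
  have hcomp : ∀ ε > 0, ∃ T, IsCompact T ∧ T ⊆ Φ '' U ∧
      ∀ y ∈ Φ '' (U ∩ D), vert y ≤ 1 / K - ε → y ∈ T := by
    intro ε hε
    obtain ⟨T, hT, hTU, hTm⟩ := hp.exists_compact_below hε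
    refine ⟨T, hT, hΦU ▸ hTU, fun y hy hyε => hTm y ?_ hyε⟩
    rw [himg] at hy
    exact hy.1
  have htest := fun φ (hφ : ContDiff ℝ ∞ φ) => transmission_image (h := 1 / K) (φ := φ) hD hUo Φ
    (fun φ hφ hφc hφU => hu.transmission hΩ hD hUo hUΩ (subset_closure.trans hDΩ) hnull hui huiu
      hue hueu hφ hφc hφU) hcomp hφ
  have key := H hp.Kminus_pos hp.Kminus_le hp.le_Kplus hK4 hp.measurable_extendGraph
    hp.le_extendGraph hp.extendGraph_le himg (Φ.toHomeomorph.isOpenMap _ (hUo.inter hD)) hτ ht hsmall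
    ENNReal.toReal_nonneg ENNReal.toReal_nonneg
    (hcont fun x hx => hui x hx.2) (hcont fun x hx => hue x (Or.inr hx.1)) hbase (hosc hfi)
    (hosc hfe) hGle htest
  rwa [LinearIsometryEquiv.norm_map] at key

/-- The left side decays like `exp (-t/2)`, the right like `exp (-t/4)`; the threshold comes from
`exp (t/4) ≥ 1 + t/4`. -/
lemma eight_rpow_mul_exp_le {m t : ℝ} (hm : 0 ≤ m) (ht : 8 * (8 : ℝ) ^ m * Real.exp (1 / 2) ≤ t) :
    1 < t ∧ 8 ^ m * Real.exp ((1 - t) / 2) ≤ Real.exp (-(t / 4)) / 2 := by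
  have h1 : (1 : ℝ) ≤ 8 ^ m := Real.one_le_rpow (by norm_num) hm
  have h2 : 1 ≤ Real.exp (1 / 2) := Real.one_le_exp (by norm_num)
  refine ⟨by nlinarith, ?_⟩
  have e : Real.exp ((1 - t) / 2)
      = Real.exp (1 / 2) * Real.exp (-(t / 4)) * Real.exp (-(t / 4)) := by
    rw [← Real.exp_add, ← Real.exp_add]
    ring_nf
  have h3 : 8 ^ m * Real.exp (1 / 2) * Real.exp (-(t / 4)) ≤ 1 / 2 := by
    rw [Real.exp_neg, ← div_eq_mul_inv, div_le_iff₀ (Real.exp_pos _)]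
    have := Real.add_one_le_exp (t / 4)
    linarith
  rw [e]
  nlinarith [mul_le_mul_of_nonneg_right h3 (Real.exp_pos (-(t / 4))).le]

/-- If the curvature gap is less than one, the pinching constants are comparable. -/
lemma le_four_mul_of_rpow_sub_lt {K Km Kp m : ℝ} (hKm : 0 < Km) (hmK : Km ≤ K) (hKp : K ≤ Kp)
    (hm : 1 / 2 ≤ m) (h : (K / Km) ^ m - (K / Kp) ^ m < 1) : K ≤ 4 * Km := by
  have hK : 0 < K := hKm.trans_le hmK
  by_contra! hlt
  -- A ratio above `4` makes the first power at least `4^(1/2) = 2`, while the second is at most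
  -- `1`.
  have h4 : 4 ≤ K / Km := (le_div_iff₀ hKm).2 hlt.le
  have h1 : (K / Kp) ^ m ≤ 1 :=
    Real.rpow_le_one (div_nonneg hK.le (hK.le.trans hKp))
      ((div_le_one (hK.trans_le hKp)).2 hKp) (by linarith)
  have h2 : (2 : ℝ) ≤ (K / Km) ^ m := by
    calc (2 : ℝ) = (4 : ℝ) ^ (1 / 2 : ℝ) := by
          rw [← Real.sqrt_eq_rpow, show (4 : ℝ) = 2 ^ 2 by norm_num]
          exact (Real.sqrt_sq (by norm_num)).symm
      _ ≤ (4 : ℝ) ^ m := Real.rpow_le_rpow_of_exponent_le (by norm_num) hm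
      _ ≤ _ := Real.rpow_le_rpow (by norm_num) h4 (by linarith)
  linarith

/-- Split `h^α` into two factors `h^(α/2)` and enlarge one to `(h + K₋⁻¹)^(α/2)`; the ratio power is
at least `1`. -/
lemma bulk_weight_le {K Km m α τ : ℝ} (hKm : 0 < Km) (hmK : Km ≤ K) (hm : 0 ≤ m) (hα : 0 < α)
    (hτ : 0 < τ) :
    (1 / K) ^ α * (τ / K) ^ (m + 1) ≤
      (1 / K + Km⁻¹) ^ (α / 2) * (1 / K) ^ (m + 1 + α / 2) * (K / Km) ^ m * τ ^ (m + 1) := by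
  have hK : 0 < K := hKm.trans_le hmK
  have hh : 0 < 1 / K := by positivity
  have h1 : (1 : ℝ) ≤ (K / Km) ^ m := Real.one_le_rpow ((one_le_div hKm).2 hmK) hm
  have h2 : (1 / K) ^ (α / 2) ≤ (1 / K + Km⁻¹) ^ (α / 2) :=
    Real.rpow_le_rpow hh.le (le_add_of_nonneg_right (by positivity)) (by positivity)
  calc (1 / K) ^ α * (τ / K) ^ (m + 1)
      = (1 / K) ^ (α / 2) * (1 / K) ^ (m + 1 + α / 2) * 1 * τ ^ (m + 1) := by
        rw [div_eq_mul_one_div τ K, Real.mul_rpow hτ.le hh.le, ← Real.rpow_add hh,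
          mul_one, mul_comm (τ ^ (m + 1)), ← mul_assoc, ← Real.rpow_add hh]
        ring_nf
    _ ≤ _ := by gcongr

lemma lid_weight_le {K Km m α τ : ℝ} (hKm : 0 < Km) (hmK : Km ≤ K) (hm : 0 ≤ m)
    (hτ : 0 < τ) :
    (1 / K) ^ α * (τ / K) ^ (m + 1) ≤
      (1 / K) ^ (α + m) * (K / Km) ^ m * (1 + τ * (1 / K)) * τ ^ m := by
  have hK : 0 < K := hKm.trans_le hmK
  have hh : 0 < 1 / K := by positivity
  have h1 : (1 : ℝ) ≤ (K / Km) ^ m := Real.one_le_rpow ((one_le_div hKm).2 hmK) hm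
  calc (1 / K) ^ α * (τ / K) ^ (m + 1)
      = (1 / K) ^ (α + m) * 1 * (0 + τ * (1 / K)) * τ ^ m := by
        rw [div_eq_mul_one_div τ K, Real.rpow_add_one (by positivity), Real.mul_rpow hτ.le hh.le,
          Real.rpow_add hh]
        ring
    _ ≤ _ := by gcongr; norm_num

end Assembly

/-! ### The theorem: separation of regimes. -/

/-- `h = 1 / K`, `b = √M / K`, `U = U_{b,h}` is the cylinder at `p` and `D_{b,h} = U ∩ D`.
`ui` is the harmonic function equal to `u` in `D`; `ue` is the harmonic function equal to `u`
outside `closure D`, harmonically extended into `U`. `G` is `∇uᵢ(p)`, the limit of `∇uᵢ` at `p`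
from within `D`, which exists as soon as the `C^{1,α}` norm of `ui` is finite. The estimate is an
inequality in `[0, ∞]`. -/
theorem theorem2p1 (n d : ℕ) (hn : 2 ≤ n) (hnd : n = d + 1) (η α : ℝ) (hη : 0 < η) (hη1 : η ≠ 1)
    (hα0 : 0 < α) (hα1 : α ≤ 1) :
    ∃ C : ℝ, 0 < C ∧
      ∀ (Ω D : Set (EuclideanSpace ℝ (Fin (d + 1)))),
        IsLipschitzDomain Ω → Bornology.IsBounded Ω →
        IsLipschitzDomain D → Bornology.IsBounded D →
        closure D ⊆ Ω → IsConnected (Ω \ closure D) →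
      ∀ (p : EuclideanSpace ℝ (Fin (d + 1))) (K L M δ Kminus Kplus : ℝ)
        (w : EuclideanSpace ℝ (Fin d) → ℝ)
        (Φ : EuclideanSpace ℝ (Fin (d + 1)) ≃ᵃⁱ[ℝ] EuclideanSpace ℝ (Fin (d + 1))),
        IsAdmissibleKCurvaturePoint D p K L M δ Kminus Kplus w Φ →
      ∀ (b h : ℝ), b = √M / K → h = 1 / K →
      ∀ (U : Set (EuclideanSpace ℝ (Fin (d + 1)))), U = Φ ⁻¹' tipCylinder d b h → U ⊆ Ω →
      ∀ (u ui ue : EuclideanSpace ℝ (Fin (d + 1)) → ℝ),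
        IsConductivitySolution Ω D η u →
        HarmonicOnNhd ui D → ui =ᵐ[volume.restrict D] u →
        HarmonicOnNhd ue ((Ω \ closure D) ∪ U) → ue =ᵐ[volume.restrict (Ω \ closure D)] u →
      ∀ (G : EuclideanSpace ℝ (Fin (d + 1))), Tendsto (gradient ui) (𝓝[D] p) (𝓝 G) →
      ∀ τ : ℝ, 0 < τ →
        HarmonicOnNhd (cgo τ (Φ.linearIsometryEquiv G)) (tipCylinder d b h) ∧
        ENNReal.ofReal (C * ‖G‖) ≤
          holderNorm α (U ∩ D) ui *
            ENNReal.ofReal ((1 + (τ * h) ^ (((n : ℝ) - 1) / 2)) * Real.exp (τ * (1 / (4 * K) - h)))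
          + holderNorm α (U ∩ D) ui *
            ENNReal.ofReal (((K / Kminus) ^ (((n : ℝ) - 1) / 2) - (K / Kplus) ^ (((n : ℝ) - 1) / 2))
              * Real.exp (τ / (4 * K)))
          + holderNorm α (U ∩ D) ui *
            ENNReal.ofReal ((h + Kminus⁻¹) ^ (α / 2) * h ^ (((n : ℝ) + 1 + α) / 2)
              * (K / Kminus) ^ (((n : ℝ) - 1) / 2) * τ ^ (((n : ℝ) + 1) / 2)
              * Real.exp (τ / (4 * K)))
          + (holderNorm α (U ∩ D) ui + holderNorm α (U ∩ D) ue) *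
            ENNReal.ofReal (h ^ (α + ((n : ℝ) - 1) / 2) * (K / Kminus) ^ (((n : ℝ) - 1) / 2)
              * (1 + τ * h) * τ ^ (((n : ℝ) - 1) / 2)
              * Real.exp (τ * (1 / (4 * K) - h))) := by
  subst hnd
  have hd : 1 ≤ d := by omega
  obtain ⟨C₁, hC₁, H⟩ := exists_estimate_holderNorm (d := d) hd hη1 hα0 hα1
  set m : ℝ := (d : ℝ) / 2 with hm
  have hd' : (1 : ℝ) ≤ d := by exact_mod_cast hd
  have hm2 : 1 / 2 ≤ m := by rw [hm]; linarith
  have hm0 : 0 ≤ m := by linarith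
  have e1 : (((d + 1 : ℕ) : ℝ) - 1) / 2 = m := by rw [hm]; push_cast; ring
  have e2 : (((d + 1 : ℕ) : ℝ) + 1) / 2 = m + 1 := by rw [hm]; push_cast; ring
  have e3 : (((d + 1 : ℕ) : ℝ) + 1 + α) / 2 = m + 1 + α / 2 := by rw [hm]; push_cast; ring
  set t₀ : ℝ := 8 * (8 : ℝ) ^ m * Real.exp (1 / 2) with ht₀
  -- The first entry bounds `T₁` from below when `τ / K < t₀`; the second absorbs the factors `2`
  -- and `C₁` of the large-frequency estimate.
  refine ⟨min (Real.exp (-(3 * t₀ / 4))) (1 / (2 + C₁)),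
    lt_min (Real.exp_pos _) (by positivity), ?_⟩
  intro Ω D hΩ _ hD _ hDΩ _ p K L M δ Kminus Kplus w Φ hp b h hb hh U hU hUΩ u ui ue hu hui huiu
    hue hueu G hG τ hτ
  refine ⟨harmonicOnNhd_cgo hd _ _ _, ?_⟩
  subst hb hh
  have hKm := hp.Kminus_pos
  have hmK := hp.Kminus_le
  have hKp := hp.le_Kplus
  have hK : 0 < K := hp.K_pos
  have hKp0 : 0 < Kplus := hK.trans_le hKp
  rw [e1, e2, e3]
  set A := holderNorm α (U ∩ D) ui with hA
  set B := holderNorm α (U ∩ D) ue with hB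
  set T₁ := (1 + (τ * (1 / K)) ^ m) * Real.exp (τ * (1 / (4 * K) - 1 / K)) with hT₁
  set T₂ := ((K / Kminus) ^ m - (K / Kplus) ^ m) * Real.exp (τ / (4 * K)) with hT₂
  set T₃ := (1 / K + Kminus⁻¹) ^ (α / 2) * (1 / K) ^ (m + 1 + α / 2) * (K / Kminus) ^ m
    * τ ^ (m + 1) * Real.exp (τ / (4 * K)) with hT₃
  set T₄ := (1 / K) ^ (α + m) * (K / Kminus) ^ m * (1 + τ * (1 / K)) * τ ^ m
    * Real.exp (τ * (1 / (4 * K) - 1 / K)) with hT₄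
  have hT₁0 : 0 ≤ T₁ := by positivity
  have hT₃0 : 0 ≤ T₃ := by positivity
  have hT₄0 : 0 < T₄ := by positivity
  have hT₂0 : 0 ≤ T₂ := by
    refine mul_nonneg (sub_nonneg.2 (Real.rpow_le_rpow (by positivity) ?_ hm0)) (Real.exp_pos _).le
    exact div_le_div_of_nonneg_left hK.le hKm (hmK.trans hKp)
  -- `T₄ > 0`, so an infinite norm makes the right-hand side infinite and no `0 * ⊤` arises there.
  by_cases hfin : A + B = ⊤
  · rw [hfin, ENNReal.top_mul (by simpa using hT₄0), add_top]
    exact le_top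
  obtain ⟨hAfin, hBfin⟩ := ENNReal.add_ne_top.1 hfin
  rw [← ENNReal.ofReal_toReal hAfin, ← ENNReal.ofReal_toReal hBfin,
    ← ENNReal.ofReal_add ENNReal.toReal_nonneg ENNReal.toReal_nonneg,
    ← ENNReal.ofReal_mul ENNReal.toReal_nonneg, ← ENNReal.ofReal_mul ENNReal.toReal_nonneg,
    ← ENNReal.ofReal_mul ENNReal.toReal_nonneg,
    ← ENNReal.ofReal_mul (add_nonneg ENNReal.toReal_nonneg ENNReal.toReal_nonneg),
    ← ENNReal.ofReal_add (by positivity) (by positivity),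
    ← ENNReal.ofReal_add (by positivity) (by positivity),
    ← ENNReal.ofReal_add (by positivity) (by positivity)]
  refine ENNReal.ofReal_le_ofReal ?_
  have hGA : ‖G‖ ≤ A.toReal := by
    rw [hA]
    subst hU
    exact hp.norm_le_of_tendsto hAfin hG
  have hA0 : 0 ≤ A.toReal := ENNReal.toReal_nonneg
  have hB0 : 0 ≤ B.toReal := ENNReal.toReal_nonneg
  have p₁ := mul_nonneg hA0 hT₁0
  have p₂ := mul_nonneg hA0 hT₂0
  have p₃ := mul_nonneg hA0 hT₃0
  have p₄ := mul_nonneg (add_nonneg hA0 hB0) hT₄0.le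
  have hG0 := norm_nonneg G
  -- At low frequency the exponent `τ (1/(4K) - h) = -3τ/(4K)` is bounded below, and the first term
  -- alone suffices.
  rcases lt_or_ge (τ / K) t₀ with ht | ht
  · have h1 : Real.exp (-(3 * t₀ / 4)) ≤ T₁ := by
      rw [hT₁, show τ * (1 / (4 * K) - 1 / K) = -(3 * (τ / K) / 4) by field_simp; ring]
      calc Real.exp (-(3 * t₀ / 4)) ≤ 1 * Real.exp (-(3 * (τ / K) / 4)) := by
            rw [one_mul, Real.exp_le_exp]
            linarith
        _ ≤ _ := by
            gcongr
            exact le_add_of_nonneg_right (by positivity)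
    calc _ ≤ Real.exp (-(3 * t₀ / 4)) * ‖G‖ := by gcongr; exact min_le_left _ _
      _ ≤ T₁ * A.toReal := by gcongr
      _ ≤ _ := by linarith
  · have hC : 1 / (2 + C₁) * ‖G‖ ≤ A.toReal * T₂ + A.toReal * T₃ + (A.toReal + B.toReal) * T₄ := by
      rw [one_div_mul_eq_div, div_le_iff₀ (by positivity)]
      -- A gap below `1` forces `K ≤ 4 K₋`, as the estimate requires; a larger gap gives `T₂ ≥ 1`
      -- and makes the second term sufficient.
      rcases lt_or_ge ((K / Kminus) ^ m - (K / Kplus) ^ m) 1 with hgap | hgap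
      · obtain ⟨ht1, hsmall⟩ := eight_rpow_mul_exp_le hm0 ht
        have key := H hΩ.isOpen hD.isOpen hDΩ hp hU hUΩ hu hui huiu hue hueu hG hτ
          (le_four_mul_of_rpow_sub_lt hKm hmK hKp hm2 hgap) ht1
          (by rwa [show τ / (4 * K) = τ / K / 4 by field_simp]) hAfin hBfin
        have h3 : A.toReal * ((1 / K) ^ α * (τ / K) ^ (m + 1) * Real.exp (τ / (4 * K)))
            ≤ A.toReal * T₃ := by
          rw [hT₃]
          exact mul_le_mul_of_nonneg_left (mul_le_mul_of_nonneg_right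
            (bulk_weight_le hKm hmK hm0 hα0 hτ) (Real.exp_pos _).le) hA0
        have h4 : (A.toReal + B.toReal) * ((1 / K) ^ α * (τ / K) ^ (m + 1)
            * Real.exp (τ * (1 / (4 * K) - 1 / K))) ≤ (A.toReal + B.toReal) * T₄ := by
          rw [hT₄]
          exact mul_le_mul_of_nonneg_left (mul_le_mul_of_nonneg_right
            (lid_weight_le hKm hmK hm0 hτ) (Real.exp_pos _).le) (add_nonneg hA0 hB0)
        have h3' := mul_le_mul_of_nonneg_left h3 hC₁
        have h4' := mul_le_mul_of_nonneg_left h4 hC₁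
        have q₂ := mul_nonneg hC₁ p₂
        linarith
      · have h2 : 1 ≤ T₂ := by
          rw [hT₂]
          exact one_le_mul_of_one_le_of_one_le hgap (Real.one_le_exp (by positivity))
        have h3 : A.toReal ≤ A.toReal * T₂ := le_mul_of_one_le_right hA0 h2
        have q₂ := mul_nonneg hC₁ p₂
        have q₃ := mul_nonneg hC₁ p₃
        have q₄ := mul_nonneg hC₁ p₄
        linarith
    calc _ ≤ 1 / (2 + C₁) * ‖G‖ := by gcongr; exact min_le_right _ _
      _ ≤ _ := by linarith
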